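/- \textbf{Setting.} Let $Q,A,S,L$ be natural numbers with $1\le A\le S$ and $A\le Q$. Time is slotted. The numbers $a[n]\in\{0,\dots,A\}$ of packets arriving at the beginning of the slots form a Markov chain with irreducible transition matrix $(\gamma_{a,a'})$ on $\{0,\dots,A\}$ and stationary distribution $\phi$; put $\alpha=\sum_a a\,\phi_a$. The channel coefficients $h[n]\in\{h_1,\dots,h_L\}\subset\mathbb{C}$, $0<|h_1|<\dots<|h_L|$, are i.i.d. with $\Pr\{h[n]=h_\iota\}=\eta_\iota$, $\sum_\iota\eta_\iota=1$, and are independent of the arrivals. Sending $s\in\{0,\dots,S\}$ packets in channel state $h_\iota$ costs power $P_{h_\iota}(s)$, where $P_{h_\iota}(0)=0$ and $P_{h_\iota}$ is nondecreasing and convex in $s$. The queue length evolves by $q[n+1]=\min\{\max\{q[n]-s[n],0\}+a[n+1],Q\}$, and only rates $s$ with $\max\{q-Q+A,0\}\le s\le\min\{q,S\}$ are allowed at queue length $q$. A policy $F$ assigns to every state $z=(q,a,\iota)$ a probability distribution on the allowed rates; it is deterministic if each of these distributions is concentrated at one rate, and unichain if the resulting Markov chain on the states has exactly one closed communicating class.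 Its average power and delay from an initial state $z_0$ are $$P_F=\lim_{N\to\infty}\frac1N\,\mathbb{E}^F_{z_0}\sum_{n=1}^N P_{h[n]}(s[n]),\qquad D_F=\lim_{N\to\infty}\frac1N\,\mathbb{E}^F_{z_0}\,\frac1\alpha\sum_{n=1}^N q[n].$$ The optimal delay-power tradeoff curve $\mathcal{L}$ (for the initial state $z_0$) is the set of all pairs $(P_F,D_F)$ that, for some $P_{\mathrm{th}}$, minimize $D_F$ over all policies $F$ with $P_F\le P_{\mathrm{th}}$. \textbf{Theorem.} For every initial state $z_0$: 1. $\mathcal{L}$ is the graph of a piecewise linear, strictly decreasing and convex function on a compact interval (possibly a single point). 2. Every vertex (end point or break point) of $\mathcal{L}$ is the power-delay pair of a deterministic unichain policy. 3. There are finitely many points $\Theta_0,\dots,\Theta_N$ of $\mathcal{L}$, with strictly increasing power and strictly decreasing delay, which include all the vertices of $\mathcal{L}$ (and possibly degenerate vertices in the interior of a linear piece), such that $\mathcal{L}$ is the union of these points and the segments $[\Theta_n,\Theta_{n+1}]$, every $\Theta_n$ is the power-delay pair of a deterministic unichain policy, and for every $n<N$ there are deterministic unichain policies with power-delay pairs $\Theta_n$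 and $\Theta_{n+1}$ that have different transmission rates in exactly one state. All the deterministic unichain policies in 2 and 3 have the stated power-delay pair from every initial state, not only from $z_0$. -/

import Mathlib

open Filter Topology

noncomputable section

/-- A buffered link over an `L`-state block fading channel with Markov arrivals. -/
structure FadingLink where
  /-- buffer size -/
  Q : ℕ
  /-- maximum number of packets arriving in a timeslot -/
  A : ℕ
  /-- maximum number of packets transmitted in a timeslot -/
  S : ℕ
  /-- number of channel states -/
  L : ℕ
  A_pos : 0 < A
  A_le_S : A ≤ S
  A_le_Q : A ≤ Q
  /-- transition probabilities of the arrival chain on `{0, …, A}` -/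
  gamma : Matrix (Fin (A + 1)) (Fin (A + 1)) ℝ
  gamma_nonneg : ∀ a a', 0 ≤ gamma a a'
  gamma_sum : ∀ a, ∑ a', gamma a a' = 1
  gamma_irreducible : gamma.IsIrreducible
  /-- the steady-state distribution of the arrival chain -/
  phi : Fin (A + 1) → ℝ
  phi_nonneg : ∀ a, 0 ≤ phi a
  phi_sum : ∑ a, phi a = 1
  phi_stationary : ∀ a', ∑ a, phi a * gamma a a' = phi a'
  /-- the channel coefficients -/
  h : Fin L → ℂ
  h_ne_zero : ∀ i, 0 < ‖h i‖
  h_strictMono : StrictMono fun i => ‖h i‖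
  /-- the channel state is i.i.d. over the timeslots, with distribution `eta` -/
  eta : Fin L → ℝ
  eta_nonneg : ∀ i, 0 ≤ eta i
  eta_sum : ∑ i, eta i = 1
  /-- `power c s` is the power used to transmit `s` packets when the channel coefficient is `c` -/
  power : ℂ → ℕ → ℝ
  power_zero : ∀ i, power (h i) 0 = 0
  power_mono : ∀ i s t, s ≤ t → t ≤ S → power (h i) s ≤ power (h i) t
  power_convex : ∀ i s, s + 2 ≤ S →
    power (h i) (s + 1) - power (h i) s ≤ power (h i) (s + 2) - power (h i) (s + 1)

namespace FadingLink

variable (M : FadingLink)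

/-- System states `(q, a, ι)`: queue length, number of arrivals, index of the channel state. -/
abbrev State : Type := Fin (M.Q + 1) × Fin (M.A + 1) × Fin M.L

/-- The average arrival rate. -/
def alpha : ℝ := ∑ a : Fin (M.A + 1), (a : ℝ) * M.phi a

/-- The rate `s ∈ {0, …, S}` is feasible for queue length `q`, that is
`max (q - Q + A) 0 ≤ s ≤ min q S`. -/
def Feasible (q : Fin (M.Q + 1)) (s : Fin (M.S + 1)) : Prop :=
  (q : ℕ) + M.A ≤ M.Q + s ∧ (s : ℕ) ≤ q

/-- The queue length after `s` transmissions followed by `a'` arrivals: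
`min (max (q - s) 0 + a') Q` (subtraction of natural numbers is truncated). -/
def nextQueue (q : Fin (M.Q + 1)) (s : Fin (M.S + 1)) (a' : Fin (M.A + 1)) : Fin (M.Q + 1) :=
  ⟨min ((q : ℕ) - s + a') M.Q, Nat.lt_succ_of_le (min_le_right _ _)⟩

/-- Stationary randomized transmission policies: `rate z s` is the probability of transmitting `s`
packets in state `z`. -/
structure Policy where
  rate : M.State → Fin (M.S + 1) → ℝ
  rate_nonneg : ∀ z s, 0 ≤ rate z s
  rate_sum : ∀ z, ∑ s, rate z s = 1
  rate_feasible : ∀ z s, ¬ M.Feasible z.1 s → rate z s = 0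

variable {M}

namespace Policy

/-- The transition matrix of the Markov chain of system states under the policy. -/
def trans (F : M.Policy) : Matrix M.State M.State ℝ := fun z z' =>
  M.gamma z.2.1 z'.2.1 * M.eta z'.2.2 *
    ∑ s, if z'.1 = M.nextQueue z.1 s z'.2.1 then F.rate z s else 0

/-- Expected power consumption in timeslot `n`, starting from `z₀` in timeslot `0`. -/
def expPower (F : M.Policy) (z₀ : M.State) (n : ℕ) : ℝ :=
  ∑ z, (F.trans ^ n) z₀ z * ∑ s, F.rate z s * M.power (M.h z.2.2) s

/-- Expected queue length in timeslot `n`, starting from `z₀` in timeslot `0`. -/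
def expQueue (F : M.Policy) (z₀ : M.State) (n : ℕ) : ℝ :=
  ∑ z, (F.trans ^ n) z₀ z * (z.1 : ℝ)

/-- Started from `z₀`, the policy has long-term average power `x.1` and average delay `x.2`. -/
def HasAverages (F : M.Policy) (z₀ : M.State) (x : ℝ × ℝ) : Prop :=
  Tendsto (fun N : ℕ => (1 / (N : ℝ)) * ∑ n ∈ Finset.Icc 1 N, F.expPower z₀ n) atTop (𝓝 x.1) ∧
  Tendsto (fun N : ℕ => (1 / (N : ℝ)) * ((1 / M.alpha) * ∑ n ∈ Finset.Icc 1 N, F.expQueue z₀ n))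
    atTop (𝓝 x.2)

/-- In every state the rate is chosen without randomization. -/
def IsDeterministic (F : M.Policy) : Prop := ∀ z, ∃ s, F.rate z s = 1

/-- `C` is a closed communicating class of the Markov chain under the policy. -/
def IsClosedClass (F : M.Policy) (C : Set M.State) : Prop :=
  C.Nonempty ∧ (∀ z ∈ C, ∀ z', 0 < F.trans z z' → z' ∈ C) ∧
    ∀ z ∈ C, ∀ z' ∈ C, ∃ n : ℕ, 0 < (F.trans ^ n) z z'

/-- The Markov chain under the policy is a unichain: it has exactly one closed class. -/
def IsUnichain (F : M.Policy) : Prop := ∃! C : Set M.State, F.IsClosedClass C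

/-- The policy is deterministic with a unichain, and its average power and delay are `x`
whatever the initial state. -/
def Obtains (F : M.Policy) (x : ℝ × ℝ) : Prop :=
  F.IsDeterministic ∧ F.IsUnichain ∧ ∀ z, F.HasAverages z x

/-- The two policies choose the rate differently in exactly one state. -/
def DifferInOneState (F F' : M.Policy) : Prop := ∃! z, F.rate z ≠ F'.rate z

end Policy

variable (M)

/-- The power-delay pairs of all policies, for the initial state `z₀`. -/
def obtainable (z₀ : M.State) : Set (ℝ × ℝ) := {x | ∃ F : M.Policy, F.HasAverages z₀ x}

/-- The optimal delay-power tradeoff curve: all power-delay pairs that minimize the average delay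
under the constraint that the average power is at most `Pth`, for some `Pth`. -/
def curve (z₀ : M.State) : Set (ℝ × ℝ) :=
  {x | x ∈ M.obtainable z₀ ∧
    ∃ Pth : ℝ, x.1 ≤ Pth ∧ ∀ y ∈ M.obtainable z₀, y.1 ≤ Pth → x.2 ≤ y.2}

end FadingLink

/-- `D` is affine on each piece of a finite subdivision of `[p, p']`. -/
def IsPiecewiseLinearOn (D : ℝ → ℝ) (p p' : ℝ) : Prop :=
  ∃ (N : ℕ) (t : Fin (N + 1) → ℝ), StrictMono t ∧ t 0 = p ∧ t (Fin.last N) = p' ∧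
    ∀ n : Fin N, ∃ c e : ℝ, ∀ x ∈ Set.Icc (t n.castSucc) (t n.succ), D x = c * x + e

end

/-! The curve is a Pareto boundary, so it is governed by the Lagrangian problems of minimizing power
plus `β` times delay. Policies may be multichain, so every obtainable pair is first placed in
`steadyPairs`, the pairs of all policies in all their stationary distributions. It then suffices to
find finitely many deterministic unichain pairs, from minimal power to minimal delay, such that
consecutive ones lie on a common line supporting `steadyPairs` and come from rules differing in one
state. Mixing two such rules in that state realizes the whole segment between them, so the polygonal
chain is the curve.

Optimal average-cost rules need not be unichain. The costs are therefore discounted by `ρ < 1` and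
perturbed by `ε` times squares. The Bellman operator is an infimal convolution in the queue length,
so the optimal value is strictly convex, and both the rate and the number of remaining packets are
monotone in the queue length (`isMonotoneRule_of_isOptimal`). If a monotone rule had two closed
classes, a closest pair of states would show one class to be a translate of the other; keeping an
extra packet forever would then cost about `β / (1 - ρ)`, more than transmitting it once. Hence
optimal rules are unichain for `ρ` near `1` (`unichain_of_isOptimal`).

For fixed `ρ` and `ε`, parametric policy improvement connects optimal rules for two weights by
changes in a single state, through rules optimal for intermediate weights
(`DecisionProcess.exists_chain`). There are finitely many rules, so along an ultrafilter with `ρ →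
1` and `ε → 0` one path serves almost all parameters. `Matrix.tendsto_discounted` turns discounted
optimality into average optimality (`exists_linked_chain`), and weights tending to `0` and to
infinity give the two ends (`exists_full_chain`). At the end of minimal delay no cheaper policy is
missed: delay `1` forces each packet to leave at once, which determines the power. -/

noncomputable section

/-! ### Finite Markov chains: closed classes, Cesàro limits, vanishing discount -/

namespace Matrix

variable {Z : Type*} [Fintype Z] {P : Matrix Z Z ℝ}

/-- `π` is a stationary probability vector of `P`. -/
structure IsStationary (P : Matrix Z Z ℝ) (π : Z → ℝ) : Prop where
  nonneg : ∀ z, 0 ≤ π z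
  sum_eq_one : ∑ z, π z = 1
  vecMul_eq : π ᵥ* P = π

lemma IsStationary.dotProduct_mulVec {π : Z → ℝ} (hπ : IsStationary P π) (f : Z → ℝ) :
    π ⬝ᵥ (P *ᵥ f) = π ⬝ᵥ f := by
  rw [Matrix.dotProduct_mulVec, hπ.vecMul_eq]

/-- `P * B = B` makes every column of `B` harmonic, hence constant. So all rows of `B` agree, and `π
ᵥ* B = π` identifies the common row. -/
lemma eq_of_harmonic_const {B : Matrix Z Z ℝ} (hconst : ∀ f : Z → ℝ, P *ᵥ f = f → ∀ z z', f z = f z')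
    {π : Z → ℝ} (hπ : IsStationary P π) (hPB : P * B = B) (hπB : π ᵥ* B = π) (z : Z) : B z = π := by
  ext z'
  have hcol := hconst (fun y => B y z') (by ext y; exact congr_fun (congr_fun hPB y) z')
  have := congr_fun hπB z'
  rw [← this]
  simp only [vecMul, dotProduct]
  simp_rw [fun y => hcol y z]
  rw [← Finset.sum_mul, hπ.sum_eq_one, one_mul]

variable [DecidableEq Z]

/-- No positive entry of `P` leads out of `K`. -/
def IsClosedSet (P : Matrix Z Z ℝ) (K : Set Z) : Prop :=
  ∀ z ∈ K, ∀ z', 0 < P z z' → z' ∈ K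

/-- `C` is a closed communicating class of `P`. -/
def IsClosedClass (P : Matrix Z Z ℝ) (C : Set Z) : Prop :=
  C.Nonempty ∧ (∀ z ∈ C, ∀ z', 0 < P z z' → z' ∈ C) ∧
    ∀ z ∈ C, ∀ z' ∈ C, ∃ n : ℕ, 0 < (P ^ n) z z'

lemma exists_pos_of_pow_succ_pos (hP : ∀ i j, 0 ≤ P i j) {n : ℕ} {i j : Z}
    (h : 0 < (P ^ (n + 1)) i j) : ∃ l, 0 < (P ^ n) i l ∧ 0 < P l j := by
  rw [pow_succ, mul_apply] at h
  obtain ⟨l, -, hl⟩ := Finset.exists_lt_of_sum_lt (f := fun _ : Z => (0 : ℝ)) (by simpa using h)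
  have h1 := pow_apply_nonneg hP n i l
  have h2 := hP l j
  refine ⟨l, h1.lt_of_ne ?_, h2.lt_of_ne ?_⟩ <;> rintro h0 <;> simp [← h0] at hl

lemma pow_succ_pos (hP : ∀ i j, 0 ≤ P i j) {n : ℕ} {i l j : Z}
    (h : 0 < (P ^ n) i l) (h' : 0 < P l j) : 0 < (P ^ (n + 1)) i j := by
  rw [pow_succ, mul_apply]
  exact Finset.sum_pos' (fun x _ => mul_nonneg (pow_apply_nonneg hP n i x) (hP x j))
    ⟨l, Finset.mem_univ l, mul_pos h h'⟩

lemma IsClosedSet.mem_of_pow_pos (hP : ∀ i j, 0 ≤ P i j) {K : Set Z} (hK : IsClosedSet P K)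
    {z : Z} (hz : z ∈ K) {n : ℕ} : ∀ {z'}, 0 < (P ^ n) z z' → z' ∈ K := by
  induction n with
  | zero =>
    intro z' h
    by_cases hzz : z = z'
    · exact hzz ▸ hz
    · simp [hzz] at h
  | succ n ih =>
    intro z' h
    obtain ⟨l, hl, hl'⟩ := exists_pos_of_pow_succ_pos hP h
    exact hK l (ih hl) z' hl'

/-- A minimal nonempty closed subset works: the states reachable from any of its points form a
closed subset, which by minimality is everything. -/
lemma exists_isClosedClass_subset (hP : ∀ i j, 0 ≤ P i j) {K : Set Z} (hne : K.Nonempty)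
    (hK : IsClosedSet P K) : ∃ C ⊆ K, IsClosedClass P C := by
  obtain ⟨C, ⟨hCK, hCne, hC⟩, hmin⟩ := Set.Finite.exists_minimal
    (Set.toFinite {C : Set Z | C ⊆ K ∧ C.Nonempty ∧ IsClosedSet P C}) ⟨K, subset_rfl, hne, hK⟩
  refine ⟨C, hCK, hCne, hC, fun z hz => ?_⟩
  have hsub : {z' | ∃ n : ℕ, 0 < (P ^ n) z z'} ⊆ C := by
    rintro z' ⟨n, hn⟩
    exact hC.mem_of_pow_pos hP hz hn
  refine hmin ⟨hsub.trans hCK, ⟨z, 0, by simp⟩, ?_⟩ hsub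
  rintro y ⟨n, hn⟩ y' hy
  exact ⟨n + 1, pow_succ_pos hP hn hy⟩

/-- Maximum principle: where a subharmonic function is maximal, its weighted average over the
successors can only keep up if each of them is maximal too. -/
lemma isClosedSet_argmax (hP : P ∈ rowStochastic ℝ Z) {f : Z → ℝ} (hf : ∀ z, f z ≤ (P *ᵥ f) z) :
    IsClosedSet P {z | ∀ z', f z' ≤ f z} := by
  intro z hz z' hpos
  by_contra hz'
  have hlt : f z' < f z := by
    refine lt_of_le_of_ne (hz z') fun h => hz' ?_
    intro y
    rw [h]
    exact hz y
  have : (P *ᵥ f) z < f z := by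
    calc (P *ᵥ f) z = ∑ y, P z y * f y := rfl
      _ < ∑ y, P z y * f z := Finset.sum_lt_sum
          (fun y _ => mul_le_mul_of_nonneg_left (hz y) (hP.1 z y))
          ⟨z', Finset.mem_univ _, mul_lt_mul_of_pos_left hlt hpos⟩
      _ = f z := by rw [← Finset.sum_mul, sum_row_of_mem_rowStochastic hP, one_mul]
  exact absurd (hf z) (not_le.2 this)

/-- A function that is harmonic for a unichain is constant. -/
lemma harmonic_const_of_unichain (hP : P ∈ rowStochastic ℝ Z)
    (huni : ∃! C : Set Z, IsClosedClass P C) {f : Z → ℝ} (hf : P *ᵥ f = f) (z z' : Z) :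
    f z = f z' := by
  have : Nonempty Z := ⟨z⟩
  obtain ⟨zM, hM⟩ := Finite.exists_max f
  obtain ⟨zm, hm⟩ := Finite.exists_min f
  obtain ⟨C₁, hC₁, h₁⟩ := exists_isClosedClass_subset hP.1 (K := {z | ∀ z', f z' ≤ f z})
    ⟨zM, hM⟩
    (isClosedSet_argmax hP (f := f) (fun z => by rw [hf]))
  obtain ⟨C₂, hC₂, h₂⟩ := exists_isClosedClass_subset hP.1 (K := {z | ∀ z', (-f) z' ≤ (-f) z})
    ⟨zm, fun z => neg_le_neg (hm z)⟩
    (isClosedSet_argmax hP (f := -f) (fun z => by rw [mulVec_neg, hf]))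
  obtain rfl := huni.unique h₁ h₂
  obtain ⟨y, hy⟩ := h₁.1
  have a := hC₁ hy
  have b := hC₂ hy
  simp only [Set.mem_ofPred_eq, Pi.neg_apply, neg_le_neg_iff] at a b
  exact le_antisymm ((a z).trans (b z')) ((a z').trans (b z))

/-- A function that is harmonic for an irreducible stochastic matrix is constant. -/
lemma harmonic_const_of_irreducible (hP : P ∈ rowStochastic ℝ Z) (hirr : P.IsIrreducible)
    {f : Z → ℝ} (hf : P *ᵥ f = f) (z z' : Z) : f z = f z' := by
  have hpow := (isIrreducible_iff_exists_pow_pos hP.1).1 hirr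
  refine harmonic_const_of_unichain hP ⟨Set.univ, ⟨⟨z, trivial⟩, fun _ _ _ _ => trivial,
    fun i _ j _ => (hpow i j).imp fun _ h => h.2⟩, ?_⟩ hf z z'
  rintro C ⟨⟨y, hy⟩, hC, -⟩
  refine Set.eq_univ_of_forall fun x => ?_
  obtain ⟨k, -, hk⟩ := hpow y x
  exact IsClosedSet.mem_of_pow_pos hP.1 hC hy hk

/-- Averages of the powers of a matrix. -/
def cesaro (P : Matrix Z Z ℝ) (N : ℕ) : Matrix Z Z ℝ :=
  (1 / (N : ℝ)) • ∑ n ∈ Finset.Icc 1 N, P ^ n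

lemma cesaro_apply (P : Matrix Z Z ℝ) (N : ℕ) (z z' : Z) :
    cesaro P N z z' = (1 / (N : ℝ)) * ∑ n ∈ Finset.Icc 1 N, (P ^ n) z z' := by
  simp [cesaro, Matrix.sum_apply]

lemma cesaro_nonneg (hP : P ∈ rowStochastic ℝ Z) (N : ℕ) (z z' : Z) : 0 ≤ cesaro P N z z' := by
  rw [cesaro_apply]
  exact mul_nonneg (by positivity) (Finset.sum_nonneg fun n _ => pow_apply_nonneg hP.1 n z z')

lemma cesaro_le_one (hP : P ∈ rowStochastic ℝ Z) (N : ℕ) (z z' : Z) : cesaro P N z z' ≤ 1 := by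
  rw [cesaro_apply]
  have : ∑ n ∈ Finset.Icc 1 N, (P ^ n) z z' ≤ N := by
    refine (Finset.sum_le_sum fun n _ => le_one_of_mem_rowStochastic (pow_mem hP n)).trans ?_
    simp
  calc _ ≤ (1 / (N : ℝ)) * N := by gcongr
    _ ≤ 1 := by rw [one_div]; exact inv_mul_le_one

lemma sum_cesaro (hP : P ∈ rowStochastic ℝ Z) {N : ℕ} (hN : N ≠ 0) (z : Z) :
    ∑ z', cesaro P N z z' = 1 := by
  simp_rw [cesaro_apply, ← Finset.mul_sum]
  rw [Finset.sum_comm]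
  simp_rw [sum_row_of_mem_rowStochastic (pow_mem hP _)]
  simp [hN]

lemma sum_Icc_pow_mul_sub (P : Matrix Z Z ℝ) (N : ℕ) :
    (∑ n ∈ Finset.Icc 1 N, P ^ n) * P - ∑ n ∈ Finset.Icc 1 N, P ^ n = P ^ (N + 1) - P := by
  induction N with
  | zero => simp
  | succ N ih =>
    rw [Finset.sum_Icc_succ_top (by omega), add_mul, ← pow_succ]
    rw [← sub_eq_zero] at ih ⊢
    rw [← ih]; abel

lemma tendsto_cesaro_mul_sub (hP : P ∈ rowStochastic ℝ Z) :
    Tendsto (fun N => cesaro P N * P - cesaro P N) atTop (𝓝 0) := by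
  have h : ∀ N, cesaro P N * P - cesaro P N = (1 / (N : ℝ)) • (P ^ (N + 1) - P) := fun N => by
    rw [← sum_Icc_pow_mul_sub, smul_sub, cesaro, smul_mul_assoc]
  simp_rw [h]
  refine tendsto_pi_nhds.2 fun z => tendsto_pi_nhds.2 fun z' => ?_
  refine squeeze_zero_norm (a := fun N : ℕ => 1 / (N : ℝ)) (fun N => ?_)
    tendsto_one_div_atTop_nhds_zero_nat
  simp only [smul_apply, sub_apply, smul_eq_mul, norm_mul, Real.norm_eq_abs]
  rw [abs_of_nonneg (by positivity : (0 : ℝ) ≤ 1 / N)]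
  refine mul_le_of_le_one_right (by positivity) ?_
  have h1 := le_one_of_mem_rowStochastic (i := z) (j := z') (pow_mem hP (N + 1))
  have h2 := pow_apply_nonneg hP.1 (N + 1) z z'
  have h3 := le_one_of_mem_rowStochastic (i := z) (j := z') hP
  have h4 := hP.1 z z'
  exact abs_le.2 ⟨by linarith, by linarith⟩

lemma mul_cesaro (P : Matrix Z Z ℝ) (N : ℕ) : P * cesaro P N = cesaro P N * P := by
  simp only [cesaro, mul_smul_comm, smul_mul_assoc, Finset.mul_sum, Finset.sum_mul, ← pow_succ,
    ← pow_succ']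

/-- Entries lie in `[0, 1]`, so compactness gives a limit along any ultrafilter. Telescoping makes
it invariant under multiplication by `P` on either side. -/
lemma exists_cesaro_limit (hP : P ∈ rowStochastic ℝ Z) (U : Ultrafilter ℕ)
    (hU : (U : Filter ℕ) ≤ atTop) :
    ∃ B, Tendsto (cesaro P) U (𝓝 B) ∧ (∀ z, IsStationary P (B z)) ∧ P * B = B := by
  obtain ⟨B, hB, hlim⟩ : ∃ B : Matrix Z Z ℝ, (∀ z z', B z z' ∈ Set.Icc (0 : ℝ) 1) ∧
      Tendsto (cesaro P) U (𝓝 B) := by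
    have hcomp : IsCompact (Set.univ.pi fun _ : Z => Set.univ.pi fun _ : Z => Set.Icc (0 : ℝ) 1) :=
      isCompact_univ_pi fun _ => isCompact_univ_pi fun _ => isCompact_Icc
    obtain ⟨B, hB, hlim⟩ := hcomp.ultrafilter_le_nhds (U.map fun N z z' => cesaro P N z z') (by
      rw [Ultrafilter.coe_map, le_principal_iff, mem_map]
      exact Filter.Eventually.of_forall fun N z _ z' _ =>
        ⟨cesaro_nonneg hP N z z', cesaro_le_one hP N z z'⟩)
    exact ⟨B, fun z z' => hB z trivial z' trivial, hlim⟩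
  have happ : ∀ z z', Tendsto (fun N => cesaro P N z z') U (𝓝 (B z z')) := fun z z' =>
    tendsto_pi_nhds.1 (tendsto_pi_nhds.1 hlim z) z'
  have hmul : B * P = B := by
    have h1 : Tendsto (fun N => cesaro P N * P - cesaro P N) U
        (𝓝 (B * P - B)) :=
      (((continuous_id.matrix_mul continuous_const).tendsto _).comp hlim).sub hlim
    exact sub_eq_zero.1 (tendsto_nhds_unique h1 ((tendsto_cesaro_mul_sub hP).mono_left hU))
  have hmul' : P * B = B := by
    have h1 : Tendsto (fun N => P * cesaro P N) U (𝓝 (P * B)) :=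
      ((continuous_const.matrix_mul continuous_id).tendsto _).comp hlim
    have h2 : Tendsto (fun N => cesaro P N * P) U (𝓝 (B * P)) :=
      ((continuous_id.matrix_mul continuous_const).tendsto _).comp hlim
    simp_rw [mul_cesaro] at h1
    exact (tendsto_nhds_unique h1 h2).trans hmul
  refine ⟨B, hlim, fun z => ⟨fun z' => (hB z z').1, ?_, ?_⟩, hmul'⟩
  · refine tendsto_nhds_unique (tendsto_finsetSum Finset.univ fun z' _ => happ z z') ?_
    refine Tendsto.congr' ?_ tendsto_const_nhds
    filter_upwards [hU (eventually_ne_atTop 0)] with N hN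
    exact (sum_cesaro hP hN z).symm
  · ext z'
    exact congr_fun (congr_fun hmul z) z'

lemma exists_isStationary [Nonempty Z] (hP : P ∈ rowStochastic ℝ Z) : ∃ π, IsStationary P π := by
  obtain ⟨B, -, hB, -⟩ := exists_cesaro_limit hP (hyperfilter ℕ) Nat.hyperfilter_le_atTop
  exact ⟨_, hB (Classical.arbitrary Z)⟩

/-- If harmonic functions are constant, then the averages of the powers converge to the stationary
probability vector. -/
theorem tendsto_cesaro (hP : P ∈ rowStochastic ℝ Z)
    (hconst : ∀ f : Z → ℝ, P *ᵥ f = f → ∀ z z', f z = f z')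
    {π : Z → ℝ} (hπ : IsStationary P π) (z z' : Z) :
    Tendsto (fun N => cesaro P N z z') atTop (𝓝 (π z')) := by
  rw [tendsto_iff_ultrafilter]
  intro U hU
  obtain ⟨B, hlim, -, hPB⟩ := exists_cesaro_limit hP U hU
  have hπB : π ᵥ* B = π := by
    have h1 : Tendsto (fun N => π ᵥ* cesaro P N) U (𝓝 (π ᵥ* B)) :=
      ((continuous_const.matrix_vecMul continuous_id).tendsto _).comp hlim
    refine tendsto_nhds_unique h1 (Tendsto.congr' ?_ tendsto_const_nhds)
    filter_upwards [hU (eventually_ne_atTop 0)] with N hN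
    have hpow : ∀ n, π ᵥ* P ^ n = π := fun n => by
      induction n with
      | zero => simp
      | succ n ih => rw [pow_succ, ← vecMul_vecMul, ih, hπ.vecMul_eq]
    rw [cesaro, vecMul_smul, vecMul_sum]
    simp [hpow, ← Nat.cast_smul_eq_nsmul ℝ, smul_smul, hN]
  rw [← congr_fun (eq_of_harmonic_const hconst hπ hPB hπB z) z']
  exact tendsto_pi_nhds.1 (tendsto_pi_nhds.1 hlim z) z'

lemma IsStationary.eq (hP : P ∈ rowStochastic ℝ Z)
    (hconst : ∀ f : Z → ℝ, P *ᵥ f = f → ∀ z z', f z = f z')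
    {π π' : Z → ℝ} (hπ : IsStationary P π) (hπ' : IsStationary P π') : π = π' := by
  ext z
  exact tendsto_nhds_unique (tendsto_cesaro hP hconst hπ z z) (tendsto_cesaro hP hconst hπ' z z)

/-- Comparison principle for discounted sums. -/
lemma nonpos_of_le_discount (hP : P ∈ rowStochastic ℝ Z) {ρ : ℝ} (hρ0 : 0 ≤ ρ) (hρ1 : ρ < 1)
    {f : Z → ℝ} (hf : ∀ z, f z ≤ ρ * (P *ᵥ f) z) (z : Z) : f z ≤ 0 := by
  have : Nonempty Z := ⟨z⟩
  obtain ⟨y, hy⟩ := Finite.exists_max f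
  have h1 : (P *ᵥ f) y ≤ f y := by
    calc (P *ᵥ f) y = ∑ x, P y x * f x := rfl
      _ ≤ ∑ x, P y x * f y :=
          Finset.sum_le_sum fun x _ => mul_le_mul_of_nonneg_left (hy x) (hP.1 y x)
      _ = f y := by rw [← Finset.sum_mul, sum_row_of_mem_rowStochastic hP, one_mul]
  have h2 : f y ≤ ρ * f y := (hf y).trans (mul_le_mul_of_nonneg_left h1 hρ0)
  exact (hy z).trans (by nlinarith)

lemma mulVec_const (hP : P ∈ rowStochastic ℝ Z) (c : ℝ) (z : Z) : (P *ᵥ fun _ => c) z = c := by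
  simp [mulVec, dotProduct, ← Finset.sum_mul, sum_row_of_mem_rowStochastic hP]

/-- The comparison principle applies to `(1 - ρ) V - c` and to its analogue for `-V`. The bound does
not depend on `ρ`, which supplies the compactness needed as `ρ → 1`. -/
lemma abs_discounted_le (hP : P ∈ rowStochastic ℝ Z) {ρ : ℝ} (hρ0 : 0 ≤ ρ) (hρ1 : ρ < 1)
    {r V : Z → ℝ} {c : ℝ} (hr : ∀ z, |r z| ≤ c) (hV : ∀ z, V z = r z + ρ * (P *ᵥ V) z) (z : Z) :
    |(1 - ρ) * V z| ≤ c := by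
  have hpos : 0 < 1 - ρ := by linarith
  have key : ∀ W s : Z → ℝ, (∀ z, s z ≤ c) → (∀ z, W z = s z + ρ * (P *ᵥ W) z) →
      (1 - ρ) * W z ≤ c := by
    intro W s hs hW
    have := nonpos_of_le_discount hP hρ0 hρ1 (f := (1 - ρ) • W - fun _ => c) (fun y => by
      rw [mulVec_sub, mulVec_smul]
      simp only [Pi.sub_apply, Pi.smul_apply, smul_eq_mul]
      rw [mulVec_const hP, hW y]
      have := hs y
      nlinarith) z
    simpa using this
  refine abs_le.2 ⟨?_, key V r (fun y => (abs_le.1 (hr y)).2) hV⟩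
  have := key (-V) (-r) (fun y => by have := (abs_le.1 (hr y)).1; simp; linarith) (fun y => by
    rw [mulVec_neg]; simp only [Pi.neg_apply]; rw [hV y]; ring)
  simp only [Pi.neg_apply] at this
  linarith

/-- Normalized discounted costs converge to the stationary average. -/
theorem tendsto_discounted (hP : P ∈ rowStochastic ℝ Z)
    (hconst : ∀ f : Z → ℝ, P *ᵥ f = f → ∀ z z', f z = f z')
    {π : Z → ℝ} (hπ : IsStationary P π) {l : Filter ℕ} {ρ : ℕ → ℝ} (hρ0 : ∀ k, 0 ≤ ρ k)
    (hρ1 : ∀ k, ρ k < 1) (hρ : Tendsto ρ l (𝓝 1)) {r V : ℕ → Z → ℝ} {r' : Z → ℝ}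
    (hr : Tendsto r l (𝓝 r')) (hV : ∀ᶠ k in l, ∀ z, V k z = r k z + ρ k * (P *ᵥ V k) z) (z : Z) :
    Tendsto (fun k => (1 - ρ k) * V k z) l (𝓝 (π ⬝ᵥ r')) := by
  rw [tendsto_iff_ultrafilter]
  intro U hU
  have hr := hr.mono_left hU
  have hρ := hρ.mono_left hU
  have hV := hV.filter_mono hU
  have hbd : ∀ᶠ k in (U : Filter ℕ), ‖r k‖ ≤ ‖r'‖ + 1 :=
    (hr.norm.eventually (eventually_lt_nhds (lt_add_one _))).mono fun _ h => h.le
  obtain ⟨W, -, hW⟩ := (isCompact_univ_pi fun _ : Z =>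
    isCompact_Icc (a := -(‖r'‖ + 1)) (b := ‖r'‖ + 1)).ultrafilter_le_nhds
      (U.map fun k z => (1 - ρ k) * V k z) (by
    rw [Ultrafilter.coe_map, le_principal_iff, mem_map]
    filter_upwards [hbd, hV] with k hk hVk z _
    exact abs_le.1 (abs_discounted_le hP (hρ0 k) (hρ1 k)
      (fun z => (norm_le_pi_norm (r k) z).trans hk) hVk z))
  have hW : Tendsto (fun k z => (1 - ρ k) * V k z) U (𝓝 W) := hW
  have hPW : Tendsto (fun k => P *ᵥ fun z => (1 - ρ k) * V k z) U (𝓝 (P *ᵥ W)) :=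
    ((continuous_const.matrix_mulVec continuous_id).tendsto W).comp hW
  have hsmul : ∀ k, (P *ᵥ fun z => (1 - ρ k) * V k z) = (1 - ρ k) • (P *ᵥ V k) := fun k => by
    rw [← mulVec_smul]; rfl
  -- Multiplied by `1 - ρ k`, the Bellman equation loses its cost term in the limit, so `W` is
  -- harmonic and therefore constant.
  have hPWW : P *ᵥ W = W := by
    have h1 : Tendsto (fun k => (1 - ρ k) • r k + ρ k • (P *ᵥ fun z => (1 - ρ k) * V k z)) U
        (𝓝 ((1 - (1 : ℝ)) • r' + (1 : ℝ) • (P *ᵥ W))) :=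
      ((tendsto_const_nhds.sub hρ).smul hr).add (hρ.smul hPW)
    rw [sub_self, zero_smul, zero_add, one_smul] at h1
    refine tendsto_nhds_unique (h1.congr' ?_) hW
    filter_upwards [hV] with k hVk
    rw [hsmul]
    ext y
    simp only [Pi.add_apply, Pi.smul_apply, smul_eq_mul]
    rw [hVk y]; ring
  -- Integrated against `π`, the Bellman equation reads `(1 - ρ k) (π ⬝ᵥ V k) = π ⬝ᵥ r k`; this
  -- identifies the constant.
  have hdot : π ⬝ᵥ W = π ⬝ᵥ r' := by
    have h1 : Tendsto (fun k => π ⬝ᵥ fun z => (1 - ρ k) * V k z) U (𝓝 (π ⬝ᵥ W)) :=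
      ((continuous_const.dotProduct continuous_id).tendsto W).comp hW
    have h2 : Tendsto (fun k => π ⬝ᵥ r k) U (𝓝 (π ⬝ᵥ r')) :=
      ((continuous_const.dotProduct continuous_id).tendsto r').comp hr
    refine tendsto_nhds_unique (h1.congr' ?_) h2
    filter_upwards [hV] with k hVk
    have h3 : π ⬝ᵥ V k = π ⬝ᵥ r k + ρ k * (π ⬝ᵥ V k) := by
      conv_lhs => rw [show V k = r k + ρ k • (P *ᵥ V k) from funext hVk]
      rw [dotProduct_add, dotProduct_smul, hπ.dotProduct_mulVec, smul_eq_mul]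
    rw [show (fun z => (1 - ρ k) * V k z) = (1 - ρ k) • V k from rfl, dotProduct_smul, smul_eq_mul]
    linarith
  have : W z = π ⬝ᵥ r' := by
    rw [← hdot, dotProduct]
    simp_rw [fun y => hconst W hPWW y z]
    rw [← Finset.sum_mul, hπ.sum_eq_one, one_mul]
  rw [← this]
  exact tendsto_pi_nhds.1 hW z

end Matrix

/-! ### Discounted decision processes and parametric policy improvement -/

/-- A finite Markov decision process without costs. -/
structure DecisionProcess (Z A : Type*) [Fintype Z] where
  /-- transition probabilities, by state and action -/
  kernel : Z → A → Z → ℝ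
  kernel_nonneg : ∀ z a z', 0 ≤ kernel z a z'
  kernel_sum : ∀ z a, ∑ z', kernel z a z' = 1
  /-- the actions allowed in a state -/
  Feasible : Z → A → Prop
  exists_feasible : ∀ z, ∃ a, Feasible z a

namespace DecisionProcess

variable {Z A : Type*} [Fintype Z] (D : DecisionProcess Z A)

/-- Cost of the action `a` in state `z` followed by the discounted continuation value `V`. -/
def actionValue (ρ : ℝ) (c : Z → A → ℝ) (V : Z → ℝ) (z : Z) (a : A) : ℝ :=
  c z a + ρ * (D.kernel z a ⬝ᵥ V)

lemma actionValue_combo (ρ : ℝ) (c₁ c₂ : Z → A → ℝ) (V₁ V₂ : Z → ℝ) (β : ℝ) (z : Z) (a : A) :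
    D.actionValue ρ (fun z a => c₁ z a + β * c₂ z a) (fun z => V₁ z + β * V₂ z) z a =
      D.actionValue ρ c₁ V₁ z a + β * D.actionValue ρ c₂ V₂ z a := by
  have : D.kernel z a ⬝ᵥ (fun z => V₁ z + β * V₂ z) =
      D.kernel z a ⬝ᵥ V₁ + β * (D.kernel z a ⬝ᵥ V₂) := by
    rw [show (fun z => V₁ z + β * V₂ z) = V₁ + β • V₂ from rfl, dotProduct_add, dotProduct_smul,
      smul_eq_mul]
  rw [actionValue, actionValue, actionValue, this]
  ring

variable [DecidableEq Z]

/-- The transition matrix under the decision rule `d`. -/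
def matrix (d : Z → A) : Matrix Z Z ℝ := fun z => D.kernel z (d z)

lemma matrix_mem (d : Z → A) : D.matrix d ∈ Matrix.rowStochastic ℝ Z :=
  Matrix.mem_rowStochastic_iff_sum.2
    ⟨fun z z' => D.kernel_nonneg z (d z) z', fun z => D.kernel_sum z (d z)⟩

/-- The discounted total cost of the decision rule `d`. -/
def value (ρ : ℝ) (c : Z → A → ℝ) (d : Z → A) : Z → ℝ :=
  (1 - ρ • D.matrix d)⁻¹.mulVec fun z => c z (d z)

variable {D} {ρ : ℝ} {c : Z → A → ℝ} {d : Z → A}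

/-- The comparison principle, applied to a kernel vector and to its negative, gives injectivity. -/
lemma isUnit_one_sub_smul (hρ0 : 0 ≤ ρ) (hρ1 : ρ < 1) : IsUnit (1 - ρ • D.matrix d) := by
  rw [← Matrix.mulVec_injective_iff_isUnit]
  have key : ∀ f : Z → ℝ, (1 - ρ • D.matrix d).mulVec f = 0 → ∀ z, f z ≤ 0 := by
    intro f hf
    refine Matrix.nonpos_of_le_discount (D.matrix_mem d) hρ0 hρ1 fun z => ?_
    have := congr_fun hf z
    rw [Matrix.sub_mulVec, Matrix.one_mulVec, Matrix.smul_mulVec] at this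
    simp only [Pi.sub_apply, Pi.smul_apply, smul_eq_mul, Pi.zero_apply] at this
    linarith
  intro f g hfg
  have h0 : (1 - ρ • D.matrix d).mulVec (f - g) = 0 := by
    rw [Matrix.mulVec_sub, sub_eq_zero]; exact hfg
  have h1 : (1 - ρ • D.matrix d).mulVec (g - f) = 0 := by
    rw [Matrix.mulVec_sub, sub_eq_zero]; exact hfg.symm
  ext z
  have a := key _ h0 z
  have b := key _ h1 z
  simp only [Pi.sub_apply] at a b
  linarith

lemma value_eq (hρ0 : 0 ≤ ρ) (hρ1 : ρ < 1) (z : Z) :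
    D.value ρ c d z = D.actionValue ρ c (D.value ρ c d) z (d z) := by
  have hu := (Matrix.isUnit_iff_isUnit_det _).1 (isUnit_one_sub_smul (D := D) (d := d) hρ0 hρ1)
  have h : (1 - ρ • D.matrix d).mulVec (D.value ρ c d) = fun z => c z (d z) := by
    rw [value, Matrix.mulVec_mulVec, Matrix.mul_nonsing_inv _ hu, Matrix.one_mulVec]
  have := congr_fun h z
  rw [Matrix.sub_mulVec, Matrix.one_mulVec, Matrix.smul_mulVec] at this
  simp only [Pi.sub_apply, Pi.smul_apply, smul_eq_mul] at this
  rw [actionValue, ← this, show D.kernel z (d z) ⬝ᵥ D.value ρ c d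
    = (D.matrix d).mulVec (D.value ρ c d) z from rfl]
  ring

lemma le_value_of_le (hρ0 : 0 ≤ ρ) (hρ1 : ρ < 1) {V : Z → ℝ}
    (hV : ∀ z, V z ≤ D.actionValue ρ c V z (d z)) (z : Z) : V z ≤ D.value ρ c d z := by
  have := Matrix.nonpos_of_le_discount (D.matrix_mem d) hρ0 hρ1 (f := V - D.value ρ c d)
    (fun y => by
      have h1 := hV y
      have h2 := value_eq (D := D) (c := c) (d := d) hρ0 hρ1 y
      rw [actionValue] at h1 h2
      rw [Matrix.mulVec_sub]
      simp only [Pi.sub_apply, Matrix.mulVec]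
      rw [matrix]
      linarith) z
  simpa using this

lemma value_le_of_le (hρ0 : 0 ≤ ρ) (hρ1 : ρ < 1) {V : Z → ℝ}
    (hV : ∀ z, D.actionValue ρ c V z (d z) ≤ V z) (z : Z) : D.value ρ c d z ≤ V z := by
  have := Matrix.nonpos_of_le_discount (D.matrix_mem d) hρ0 hρ1 (f := D.value ρ c d - V)
    (fun y => by
      have h1 := hV y
      have h2 := value_eq (D := D) (c := c) (d := d) hρ0 hρ1 y
      rw [actionValue] at h1 h2
      rw [Matrix.mulVec_sub]
      simp only [Pi.sub_apply, Matrix.mulVec]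
      rw [matrix]
      linarith) z
  simpa using this

lemma eq_value_of_eq (hρ0 : 0 ≤ ρ) (hρ1 : ρ < 1) {V : Z → ℝ}
    (hV : ∀ z, V z = D.actionValue ρ c V z (d z)) : V = D.value ρ c d :=
  funext fun z => le_antisymm (le_value_of_le hρ0 hρ1 (fun y => (hV y).le) z)
    (value_le_of_le hρ0 hρ1 (fun y => (hV y).ge) z)

/-- For a fixed rule the value is affine in the weight `β`; hence each optimality inequality is
affine in `β` as well. -/
lemma value_combo (hρ0 : 0 ≤ ρ) (hρ1 : ρ < 1) (c₁ c₂ : Z → A → ℝ) (β : ℝ) :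
    D.value ρ (fun z a => c₁ z a + β * c₂ z a) d =
      fun z => D.value ρ c₁ d z + β * D.value ρ c₂ d z := by
  refine (eq_value_of_eq hρ0 hρ1 fun z => ?_).symm
  rw [actionValue_combo, ← value_eq hρ0 hρ1, ← value_eq hρ0 hρ1]

variable (D) in
/-- The decision rule `d` minimizes the discounted total cost from every initial state. -/
def IsOptimal (ρ : ℝ) (c : Z → A → ℝ) (d : Z → A) : Prop :=
  (∀ z, D.Feasible z (d z)) ∧
    ∀ z a, D.Feasible z a → D.value ρ c d z ≤ D.actionValue ρ c (D.value ρ c d) z a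

/-- Switching in one state to an action of lower cost lowers the total cost. -/
lemma value_update_le (hρ0 : 0 ≤ ρ) (hρ1 : ρ < 1) {z : Z} {a : A}
    (h : D.actionValue ρ c (D.value ρ c d) z a ≤ D.value ρ c d z) :
    (∀ y, D.value ρ c (Function.update d z a) y ≤ D.value ρ c d y) ∧
      D.value ρ c (Function.update d z a) z ≤ D.actionValue ρ c (D.value ρ c d) z a := by
  have h1 : ∀ y, D.value ρ c (Function.update d z a) y ≤ D.value ρ c d y := by
    refine value_le_of_le hρ0 hρ1 fun y => ?_
    by_cases hy : y = z
    · subst hy; simpa using h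
    · rw [Function.update_of_ne hy, ← value_eq hρ0 hρ1]
  refine ⟨h1, ?_⟩
  rw [value_eq hρ0 hρ1, Function.update_self, actionValue, actionValue]
  gcongr
  exact Finset.sum_le_sum fun y _ => mul_le_mul_of_nonneg_left (h1 y) (D.kernel_nonneg z a y)

/-- Among the finitely many feasible rules, one minimizes the sum of the values over all states. A
profitable switch in one state would lower this sum. -/
lemma exists_isOptimal [Finite A] (hρ0 : 0 ≤ ρ) (hρ1 : ρ < 1) (c : Z → A → ℝ) :
    ∃ d, D.IsOptimal ρ c d := by
  have hne : ({d | ∀ z, D.Feasible z (d z)} : Set (Z → A)).Nonempty :=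
    ⟨fun z => (D.exists_feasible z).choose, fun z => (D.exists_feasible z).choose_spec⟩
  obtain ⟨d, hd, hmin⟩ := Set.exists_min_image _ (fun d => ∑ z, D.value ρ c d z)
    (Set.toFinite _) hne
  refine ⟨d, hd, fun z a ha => ?_⟩
  by_contra! hlt
  obtain ⟨h1, h2⟩ := value_update_le hρ0 hρ1 hlt.le
  refine absurd (hmin (Function.update d z a) fun y => ?_) (not_le.2 ?_)
  · by_cases hy : y = z
    · subst hy; simpa using ha
    · rw [Function.update_of_ne hy]; exact hd y
  · exact Finset.sum_lt_sum (fun y _ => h1 y) ⟨z, Finset.mem_univ z, h2.trans_lt hlt⟩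

variable (D) in
/-- The two decision rules differ in exactly one state, `d'` is no worse than `d` for the second
cost, and both minimize the first cost plus `β` times the second, for some `β ∈ [β₀, β₁]`. -/
def Adjacent (ρ : ℝ) (c₁ c₂ : Z → A → ℝ) (β₀ β₁ : ℝ) (d d' : Z → A) : Prop :=
  (∃! z, d z ≠ d' z) ∧ (∀ z, D.value ρ c₂ d' z ≤ D.value ρ c₂ d z) ∧
    ∃ β ∈ Set.Icc β₀ β₁, D.IsOptimal ρ (fun z a => c₁ z a + β * c₂ z a) d ∧
      D.IsOptimal ρ (fun z a => c₁ z a + β * c₂ z a) d'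

/-- An optimal decision rule that does not stay optimal when the weight of the second cost
increases can be changed in one state, so that the second cost decreases. -/
lemma exists_improvement [Finite A] (hρ0 : 0 ≤ ρ) (hρ1 : ρ < 1) {c₁ c₂ : Z → A → ℝ} {β β₁ : ℝ}
    (hβ : β ≤ β₁) (hd : D.IsOptimal ρ (fun z a => c₁ z a + β * c₂ z a) d)
    (hd₁ : ¬ D.IsOptimal ρ (fun z a => c₁ z a + β₁ * c₂ z a) d) :
    ∃ d', ∃ β' ∈ Set.Icc β β₁, (∃! z, d z ≠ d' z) ∧
      (∀ z, D.value ρ c₂ d' z ≤ D.value ρ c₂ d z) ∧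
      (∑ z, D.value ρ c₂ d' z < ∑ z, D.value ρ c₂ d z) ∧
      D.IsOptimal ρ (fun z a => c₁ z a + β' * c₂ z a) d ∧
      D.IsOptimal ρ (fun z a => c₁ z a + β' * c₂ z a) d' := by
  set a₁ : Z × A → ℝ := fun x => D.actionValue ρ c₁ (D.value ρ c₁ d) x.1 x.2 - D.value ρ c₁ d x.1
    with ha₁
  set a₂ : Z × A → ℝ := fun x => D.actionValue ρ c₂ (D.value ρ c₂ d) x.1 x.2 - D.value ρ c₂ d x.1
    with ha₂
  have hadv : ∀ b x, D.actionValue ρ (fun z a => c₁ z a + b * c₂ z a)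
      (D.value ρ (fun z a => c₁ z a + b * c₂ z a) d) x.1 x.2 -
      D.value ρ (fun z a => c₁ z a + b * c₂ z a) d x.1 = a₁ x + b * a₂ x := fun b x => by
    rw [value_combo hρ0 hρ1, actionValue_combo]; ring
  have hopt : ∀ b, D.IsOptimal ρ (fun z a => c₁ z a + b * c₂ z a) d ↔
      ∀ x : Z × A, D.Feasible x.1 x.2 → 0 ≤ a₁ x + b * a₂ x := fun b =>
    ⟨fun h x hx => by rw [← hadv]; exact sub_nonneg.2 (h.2 _ _ hx),
      fun h => ⟨hd.1, fun z a ha => sub_nonneg.1 (by rw [hadv b (z, a)]; exact h _ ha)⟩⟩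
  have h0 := (hopt β).1 hd
  rw [hopt] at hd₁
  push Not at hd₁
  obtain ⟨x₁, hx₁, hlt₁⟩ := hd₁
  have hneg₁ : a₂ x₁ < 0 := by
    by_contra! h
    nlinarith [h0 x₁ hx₁, mul_nonneg (sub_nonneg.2 hβ) h]
  -- Only actions with `a₂ < 0` can violate optimality as the weight grows. The least ratio `a₁ /
  -- (-a₂)` is the first weight at which one of them ties with `d`.
  obtain ⟨⟨z, a⟩, ⟨hfeas, hneg⟩, hmin⟩ := Set.exists_min_image
    {x : Z × A | D.Feasible x.1 x.2 ∧ a₂ x < 0} (fun x => a₁ x / (-a₂ x)) (Set.toFinite _)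
    ⟨x₁, hx₁, hneg₁⟩
  set b := a₁ (z, a) / (-a₂ (z, a)) with hb
  have hb0 : a₁ (z, a) + b * a₂ (z, a) = 0 := by
    rw [hb]; field_simp [hneg.ne]; ring
  have hβb : β ≤ b := by
    rw [hb, le_div_iff₀ (by linarith)]
    linarith [h0 _ hfeas]
  have hb₁ : b ≤ β₁ := by
    refine (hmin x₁ ⟨hx₁, hneg₁⟩).trans ?_
    rw [div_le_iff₀ (by linarith)]
    linarith
  have hdb : D.IsOptimal ρ (fun z a => c₁ z a + b * c₂ z a) d := by
    rw [hopt]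
    intro x hx
    rcases lt_or_ge (a₂ x) 0 with h | h
    · have := hmin x ⟨hx, h⟩
      rw [le_div_iff₀ (by linarith)] at this
      linarith
    · nlinarith [h0 x hx, mul_nonneg (sub_nonneg.2 hβb) h]
  have hda : d z ≠ a := by
    rintro rfl
    rw [ha₂] at hneg
    simp only at hneg
    rw [← value_eq hρ0 hρ1] at hneg
    linarith
  have hneg' : D.actionValue ρ c₂ (D.value ρ c₂ d) z a < D.value ρ c₂ d z := sub_neg.1 hneg
  obtain ⟨h1, h2⟩ := value_update_le hρ0 hρ1 hneg'.le
  -- At the critical weight the switch is free, so the old value solves the equation of the new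
  -- rule: the values coincide and both rules are optimal.
  have hval : D.value ρ (fun z a => c₁ z a + b * c₂ z a) d =
      D.value ρ (fun z a => c₁ z a + b * c₂ z a) (Function.update d z a) := by
    refine eq_value_of_eq hρ0 hρ1 fun y => ?_
    by_cases hy : y = z
    · subst hy
      rw [Function.update_self]
      linarith [hadv b (y, a)]
    · rw [Function.update_of_ne hy]
      exact value_eq hρ0 hρ1 y
  refine ⟨Function.update d z a, b, ⟨hβb, hb₁⟩, ⟨z, by simpa using hda, fun y hy => ?_⟩, h1,
    Finset.sum_lt_sum (fun y _ => h1 y) ⟨z, Finset.mem_univ z, h2.trans_lt hneg'⟩, hdb,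
    fun y => ?_, ?_⟩
  · by_contra hyz
    exact hy (Function.update_of_ne hyz _ _).symm
  · by_cases hy : y = z
    · subst hy; simpa using hfeas
    · rw [Function.update_of_ne hy]; exact hd.1 y
  · rw [← hval]; exact hdb.2

/-- Decision rules that are optimal for two weights of the second cost are connected by a chain of
one-state changes through optimal decision rules for weights in between. -/
theorem exists_chain [Finite A] (hρ0 : 0 ≤ ρ) (hρ1 : ρ < 1) {c₁ c₂ : Z → A → ℝ} {β₀ β₁ : ℝ}
    (hβ : β₀ ≤ β₁) (hd : D.IsOptimal ρ (fun z a => c₁ z a + β₀ * c₂ z a) d) :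
    ∃ d', D.IsOptimal ρ (fun z a => c₁ z a + β₁ * c₂ z a) d' ∧
      Relation.ReflTransGen (D.Adjacent ρ c₁ c₂ β₀ β₁) d d' := by
  -- The sum of the second values drops strictly at each improvement, and there are finitely many
  -- rules, so the process terminates.
  have hwf : WellFounded fun d d' : Z → A =>
      ∑ z, D.value ρ c₂ d z < ∑ z, D.value ρ c₂ d' z :=
    @Finite.wellFounded_of_trans_of_irrefl _ _ _ ⟨fun _ _ _ => lt_trans⟩ ⟨fun _ => lt_irrefl _⟩
  suffices ∀ d, ∀ β ∈ Set.Icc β₀ β₁, D.IsOptimal ρ (fun z a => c₁ z a + β * c₂ z a) d →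
      ∃ d', D.IsOptimal ρ (fun z a => c₁ z a + β₁ * c₂ z a) d' ∧
        Relation.ReflTransGen (D.Adjacent ρ c₁ c₂ β₀ β₁) d d' from
    this d β₀ ⟨le_rfl, hβ⟩ hd
  intro d
  induction d using hwf.induction with
  | _ d ih =>
    intro β hβ hd
    by_cases h₁ : D.IsOptimal ρ (fun z a => c₁ z a + β₁ * c₂ z a) d
    · exact ⟨d, h₁, .refl⟩
    obtain ⟨d', β', hβ', hone, hle, hlt, ho, ho'⟩ := exists_improvement hρ0 hρ1 hβ.2 hd h₁
    have hmem : β' ∈ Set.Icc β₀ β₁ := ⟨hβ.1.trans hβ'.1, hβ'.2⟩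
    obtain ⟨d₁, hd₁, hpath⟩ := ih d' hlt β' hmem ho'
    exact ⟨d₁, hd₁, hpath.head ⟨hone, hle, β', hmem, ho, ho'⟩⟩

end DecisionProcess


/-! ### Discrete convexity: infimal convolution and monotone splittings -/

/-- The increments of `f` on `{0, …, n}` grow by at least `δ` in every step. -/
def StepConvex (δ : ℝ) (f : ℕ → ℝ) (n : ℕ) : Prop :=
  ∀ i, i + 2 ≤ n → f (i + 1) - f i + δ ≤ f (i + 2) - f (i + 1)

namespace StepConvex

variable {δ : ℝ} {f P W : ℕ → ℝ} {m n : ℕ}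

lemma lt_increment (hf : StepConvex δ f n) (hδ : 0 < δ) {i k : ℕ} (hik : i < k) (hk : k + 1 ≤ n) :
    f (i + 1) - f i < f (k + 1) - f k := by
  induction k, hik using Nat.le_induction with
  | base => linarith [hf i hk]
  | succ k hk' ih => linarith [ih (by omega), hf k hk]

lemma increment_le (hf : StepConvex 0 f n) {i k : ℕ} (hik : i ≤ k) (hk : k + 1 ≤ n) :
    f (i + 1) - f i ≤ f (k + 1) - f k := by
  induction k, hik using Nat.le_induction with
  | base => rfl
  | succ k hk' ih => linarith [ih (by omega), hf k hk]

lemma mono (hf : StepConvex δ f n) {δ' : ℝ} (h : δ' ≤ δ) : StepConvex δ' f n :=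
  fun i hi => by linarith [hf i hi]

/-- The infimal convolution of convex sequences is convex. -/
lemma infConv (hP : StepConvex 0 P m) (hW : StepConvex 0 W n) {g : ℕ → ℝ} {N : ℕ}
    (hle : ∀ s u, s ≤ m → u ≤ n → s + u ≤ N → g (s + u) ≤ P s + W u)
    (heq : ∀ q ≤ N, ∃ s u, s ≤ m ∧ u ≤ n ∧ s + u = q ∧ g q = P s + W u) : StepConvex 0 g N := by
  intro q hq
  obtain ⟨s, u, hs, hu, hsu, h⟩ := heq q (by omega)
  obtain ⟨s', u', hs', hu', hsu', h'⟩ := heq (q + 2) hq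
  suffices g (q + 1) + g (q + 1) ≤ P s + W u + (P s' + W u') by linarith
  -- Two splittings of `q + 1` are made from those of `q` and `q + 2`. If one part grows by at least
  -- `2`, a unit of that part is moved between the two splittings; otherwise both parts grow by
  -- exactly `1`, and exchanging parts works.
  rcases le_or_gt (s + 2) s' with hss | hss
  · obtain ⟨t, rfl⟩ : ∃ t, s' = t + 1 := ⟨s' - 1, by omega⟩
    have h1 := hle (s + 1) u (by omega) hu (by omega)
    have h2 := hle t u' (by omega) hu' (by omega)
    have h3 := hP.increment_le (show s ≤ t by omega) hs'
    rw [show s + 1 + u = q + 1 by omega] at h1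
    rw [show t + u' = q + 1 by omega] at h2
    linarith
  rcases le_or_gt (u + 2) u' with huu | huu
  · obtain ⟨t, rfl⟩ : ∃ t, u' = t + 1 := ⟨u' - 1, by omega⟩
    have h1 := hle s (u + 1) hs (by omega) (by omega)
    have h2 := hle s' t hs' (by omega) (by omega)
    have h3 := hW.increment_le (show u ≤ t by omega) hu'
    rw [show s + (u + 1) = q + 1 by omega] at h1
    rw [show s' + t = q + 1 by omega] at h2
    linarith
  · have h1 := hle s u' hs hu' (by omega)
    have h2 := hle s' u hs' hu (by omega)
    rw [show s + u' = q + 1 by omega] at h1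
    rw [show s' + u = q + 1 by omega] at h2
    linarith

/-- In optimal splittings of `q` and `q + 1`, the first part is monotone if the cost of the second
part is strictly convex. -/
lemma left_le (hW : StepConvex δ W n) (hδ : 0 < δ) {s u s' u' : ℕ} (hu' : u' ≤ n)
    (hsum : s' + u' = s + u + 1)
    (hmin : ∀ v, v ≤ n → s' + v = s + u → P s + W u ≤ P s' + W v)
    (hmin' : ∀ v, v ≤ n → s + v = s + u + 1 → P s' + W u' ≤ P s + W v) : s ≤ s' := by
  by_contra! hlt
  -- Here `s' < s` forces `u' ≥ u + 2`. Exchanging `s` and `s'` between the two splittings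
  -- contradicts strict convexity of `W`, because the terms in `P` cancel.
  obtain ⟨t, rfl⟩ : ∃ t, u' = t + 1 := ⟨u' - 1, by omega⟩
  have h1 := hmin t (by omega) (by omega)
  have h2 := hmin' (u + 1) (by omega) (by omega)
  have h3 := hW.lt_increment hδ (show u < t by omega) hu'
  linarith

end StepConvex

/-! ### Convex values and monotone optimal rules for the link -/

namespace FadingLink

variable (M : FadingLink)

/-- `q` as a queue length, truncated at the buffer size. -/
def clip (q : ℕ) : Fin (M.Q + 1) := ⟨min q M.Q, Nat.lt_succ_of_le (min_le_right _ _)⟩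

/-- The Markov decision process of the link. -/
def process : DecisionProcess M.State (Fin (M.S + 1)) where
  kernel z s z' := M.gamma z.2.1 z'.2.1 * M.eta z'.2.2 *
    if z'.1 = M.nextQueue z.1 s z'.2.1 then 1 else 0
  kernel_nonneg z s z' := mul_nonneg (mul_nonneg (M.gamma_nonneg _ _) (M.eta_nonneg _))
    (by split_ifs <;> norm_num)
  kernel_sum z s := by
    rw [Fintype.sum_prod_type, Finset.sum_comm]
    simp [Fintype.sum_prod_type, ← Finset.mul_sum, M.eta_sum, M.gamma_sum]
  Feasible z s := M.Feasible z.1 s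
  exists_feasible z := ⟨⟨min z.1 M.S, Nat.lt_succ_of_le (min_le_right _ _)⟩, by
    have := M.A_le_S
    have := z.1.2
    have := M.A_le_Q
    refine ⟨?_, min_le_left _ _⟩
    change (z.1 : ℕ) + M.A ≤ M.Q + min (z.1 : ℕ) M.S
    omega⟩

variable {M}

/-- Expectation of a function of the next state. -/
lemma kernel_dotProduct (z : M.State) (s : Fin (M.S + 1)) (V : M.State → ℝ) :
    M.process.kernel z s ⬝ᵥ V =
      ∑ a', ∑ i', M.gamma z.2.1 a' * M.eta i' * V (M.nextQueue z.1 s a', a', i') := by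
  rw [dotProduct, Fintype.sum_prod_type, Finset.sum_comm]
  simp [process, Fintype.sum_prod_type]

variable (M) in
/-- Power consumption, with a strictly convex perturbation. -/
def powerCost (ε : ℝ) (z : M.State) (s : Fin (M.S + 1)) : ℝ :=
  M.power (M.h z.2.2) s + ε * (s : ℝ) ^ 2

variable (M) in
/-- Queue length, with a strictly convex perturbation. -/
def queueCost (ε : ℝ) (z : M.State) (_ : Fin (M.S + 1)) : ℝ :=
  (z.1 : ℝ) + ε * (z.1 : ℝ) ^ 2

variable (M) in
/-- Weighted sum of the perturbed power consumption and the perturbed queue length. -/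
def cost (ε β : ℝ) (z : M.State) (s : Fin (M.S + 1)) : ℝ :=
  M.powerCost ε z s + β * M.queueCost ε z s

/-- Discounted expected value after the transmission, if `u` packets remain. -/
def continuation (ρ : ℝ) (V : M.State → ℝ) (a : Fin (M.A + 1)) (u : ℕ) : ℝ :=
  ρ * ∑ a', ∑ i', M.gamma a a' * M.eta i' * V (M.clip (u + a'), a', i')

/-- For given arrivals and channel state, the action-dependent terms split into a function of `s`
and a function of the remaining packets `z.1 - s`, so minimizing over `s` is an infimal convolution.
-/
lemma actionValue_eq (ρ ε β : ℝ) (V : M.State → ℝ) (z : M.State) (s : Fin (M.S + 1)) :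
    M.process.actionValue ρ (M.cost ε β) V z s =
      M.power (M.h z.2.2) s + ε * (s : ℝ) ^ 2 + continuation ρ V z.2.1 (z.1 - s) +
        β * ((z.1 : ℝ) + ε * (z.1 : ℝ) ^ 2) := by
  rw [DecisionProcess.actionValue, kernel_dotProduct, cost, powerCost, queueCost, continuation]
  simp only [nextQueue, clip]
  ring

/-- Feasible rates leave at most `Q - A` packets. In that range arrivals cannot overflow the buffer,
so `clip` is inactive and convexity is simply averaged. -/
lemma stepConvex_continuation {ρ δ : ℝ} (hρ0 : 0 ≤ ρ) {V : M.State → ℝ}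
    (hV : ∀ a i, StepConvex δ (fun q => V (M.clip q, a, i)) M.Q) (a : Fin (M.A + 1)) :
    StepConvex (ρ * δ) (continuation ρ V a) (M.Q - M.A) := by
  intro u hu
  have h1 : ∑ a', ∑ i', M.gamma a a' * M.eta i' * δ = δ := by
    simp [← Finset.sum_mul, ← Finset.mul_sum, M.eta_sum, M.gamma_sum]
  simp only [continuation]
  rw [← h1, ← mul_sub, ← mul_sub, ← mul_add]
  refine mul_le_mul_of_nonneg_left ?_ hρ0
  simp only [← Finset.sum_sub_distrib, ← Finset.sum_add_distrib]
  refine Finset.sum_le_sum fun a' _ => Finset.sum_le_sum fun i' _ => ?_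
  have h2 := hV a' i' (u + a') (by have := a'.2; omega)
  rw [← mul_sub, ← mul_sub, ← mul_add]
  refine mul_le_mul_of_nonneg_left ?_ (mul_nonneg (M.gamma_nonneg _ _) (M.eta_nonneg _))
  rw [show u + 1 + (a' : ℕ) = u + a' + 1 by ring, show u + 2 + (a' : ℕ) = u + a' + 2 by ring]
  exact h2

lemma stepConvex_power {ε : ℝ} (i : Fin M.L) :
    StepConvex (2 * ε) (fun s => M.power (M.h i) s + ε * (s : ℝ) ^ 2) M.S := by
  intro s hs
  have := M.power_convex i s hs
  push_cast
  linarith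

lemma clip_coe {q : ℕ} (hq : q ≤ M.Q) : (M.clip q : ℕ) = q := min_eq_left hq

/-- The Bellman operator preserves convexity in the queue length. -/
lemma stepConvex_bellman {ρ ε β : ℝ} (hρ0 : 0 ≤ ρ) (hε : 0 ≤ ε) {V V' : M.State → ℝ}
    (hV : ∀ a i, StepConvex 0 (fun q => V (M.clip q, a, i)) M.Q)
    (hle : ∀ z s, M.Feasible z.1 s → V' z ≤ M.process.actionValue ρ (M.cost ε β) V z s)
    (heq : ∀ z, ∃ s, M.Feasible z.1 s ∧ V' z = M.process.actionValue ρ (M.cost ε β) V z s)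
    (a : Fin (M.A + 1)) (i : Fin M.L) :
    StepConvex (2 * (β * ε)) (fun q => V' (M.clip q, a, i)) M.Q := by
  have hAQ := M.A_le_Q
  -- Without the queue cost, the minimum is an infimal convolution, hence convex. The subtracted
  -- term has second difference `2 * (β * ε)`.
  have key : StepConvex 0 (fun q => V' (M.clip q, a, i) - β * ((q : ℝ) + ε * (q : ℝ) ^ 2)) M.Q := by
    refine StepConvex.infConv (P := fun s => M.power (M.h i) s + ε * (s : ℝ) ^ 2)
      (W := continuation ρ V a) ((stepConvex_power i).mono (by linarith))
      ((stepConvex_continuation hρ0 hV a).mono (by simp)) ?_ ?_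
    · intro s u hs hu hsu
      have := hle (M.clip (s + u), a, i) ⟨s, by omega⟩
        ⟨by simp only [clip_coe hsu]; omega, by simp only [clip_coe hsu]; omega⟩
      rw [actionValue_eq] at this
      simp only [clip_coe hsu, Nat.add_sub_cancel_left] at this
      linarith
    · intro q hq
      obtain ⟨s, ⟨hs1, hs2⟩, h⟩ := heq (M.clip q, a, i)
      rw [actionValue_eq] at h
      simp only [clip_coe hq] at h hs1 hs2
      exact ⟨s, q - s, by omega, by omega, by omega, by rw [h]; ring⟩
  intro q hq
  have := key q hq
  push_cast at this
  linarith

lemma exists_bellman (ρ : ℝ) (c : M.State → Fin (M.S + 1) → ℝ) (V : M.State → ℝ) :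
    ∃ V' : M.State → ℝ, (∀ z s, M.Feasible z.1 s → V' z ≤ M.process.actionValue ρ c V z s) ∧
      ∀ z, ∃ s, M.Feasible z.1 s ∧ V' z = M.process.actionValue ρ c V z s := by
  have : ∀ z, ∃ s, M.Feasible z.1 s ∧ ∀ t, M.Feasible z.1 t →
      M.process.actionValue ρ c V z s ≤ M.process.actionValue ρ c V z t := fun z =>
    Set.exists_min_image {s | M.Feasible z.1 s} _ (Set.toFinite _) (M.process.exists_feasible z)
  choose e he hmin using this
  exact ⟨fun z => M.process.actionValue ρ c V z (e z), fun z s hs => hmin z s hs,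
    fun z => ⟨e z, he z, rfl⟩⟩

lemma actionValue_le_add {ρ B : ℝ} (hρ0 : 0 ≤ ρ) {c : M.State → Fin (M.S + 1) → ℝ}
    {V V' : M.State → ℝ} (h : ∀ z, V z ≤ V' z + B) (z : M.State) (s : Fin (M.S + 1)) :
    M.process.actionValue ρ c V z s ≤ M.process.actionValue ρ c V' z s + ρ * B := by
  have : M.process.kernel z s ⬝ᵥ V ≤ M.process.kernel z s ⬝ᵥ V' + B := by
    calc _ ≤ ∑ z', M.process.kernel z s z' * (V' z' + B) := Finset.sum_le_sum fun z' _ =>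
          mul_le_mul_of_nonneg_left (h z') (M.process.kernel_nonneg z s z')
      _ = _ := by
          simp_rw [mul_add]
          rw [Finset.sum_add_distrib, ← Finset.sum_mul, M.process.kernel_sum, one_mul, dotProduct]
  rw [DecisionProcess.actionValue, DecisionProcess.actionValue]
  nlinarith [mul_le_mul_of_nonneg_left this hρ0]

/-- The optimal discounted cost is strictly convex in the queue length. -/
lemma stepConvex_value {ρ ε β : ℝ} (hρ0 : 0 ≤ ρ) (hρ1 : ρ < 1) (hε : 0 ≤ ε) (hβ : 0 ≤ β)
    {d : M.State → Fin (M.S + 1)} (hd : M.process.IsOptimal ρ (M.cost ε β) d)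
    (a : Fin (M.A + 1)) (i : Fin M.L) :
    StepConvex (2 * (β * ε)) (fun q => M.process.value ρ (M.cost ε β) d (M.clip q, a, i)) M.Q := by
  set V := M.process.value ρ (M.cost ε β) d with hVdef
  have hVeq : ∀ z, V z = M.process.actionValue ρ (M.cost ε β) V z (d z) := fun z =>
    DecisionProcess.value_eq hρ0 hρ1 z
  -- Value iteration from `0` stays convex and approaches `V` at geometric rate.
  have iter : ∀ n : ℕ, ∃ f : M.State → ℝ,
      (∀ a i, StepConvex 0 (fun q => f (M.clip q, a, i)) M.Q) ∧
      ∀ z, f z ≤ V z + ρ ^ n * ‖V‖ ∧ V z ≤ f z + ρ ^ n * ‖V‖ := by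
    intro n
    induction n with
    | zero =>
      refine ⟨0, fun a i q _ => by simp, fun z => ?_⟩
      have := abs_le.1 (norm_le_pi_norm V z)
      simp only [Pi.zero_apply, pow_zero, one_mul, zero_add]
      exact ⟨by linarith, this.2⟩
    | succ n ih =>
      obtain ⟨f, hf, hfV⟩ := ih
      obtain ⟨g, hle, heq⟩ := exists_bellman ρ (M.cost ε β) f
      refine ⟨g, fun a i => (stepConvex_bellman hρ0 hε hf hle heq a i).mono (by positivity),
        fun z => ⟨?_, ?_⟩⟩
      · have h1 := actionValue_le_add (c := M.cost ε β) hρ0 (fun z => (hfV z).1) z (d z)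
        rw [← hVeq] at h1
        rw [pow_succ']
        linarith [hle z (d z) (hd.1 z)]
      · obtain ⟨s, hs, hgs⟩ := heq z
        have h1 := actionValue_le_add (c := M.cost ε β) hρ0 (fun z => (hfV z).2) z s
        rw [← hgs] at h1
        rw [pow_succ']
        linarith [hd.2 z s hs]
  have hV0 : ∀ a i, StepConvex 0 (fun q => V (M.clip q, a, i)) M.Q := by
    intro a i q hq
    -- A second difference has total weight `4`: the middle value counts twice.
    have hlim : Tendsto (fun n : ℕ => 4 * (ρ ^ n * ‖V‖)) atTop (𝓝 0) := by
      simpa using ((tendsto_pow_atTop_nhds_zero_of_lt_one hρ0 hρ1).mul_const ‖V‖).const_mul 4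
    have : ∀ n : ℕ, V (M.clip (q + 1), a, i) - V (M.clip q, a, i) -
        (V (M.clip (q + 2), a, i) - V (M.clip (q + 1), a, i)) ≤ 4 * (ρ ^ n * ‖V‖) := fun n => by
      obtain ⟨f, hf, hfV⟩ := iter n
      have h := hf a i q hq
      simp only at h
      linarith [(hfV (M.clip (q + 1), a, i)).2, (hfV (M.clip q, a, i)).1,
        (hfV (M.clip (q + 2), a, i)).1]
    have := ge_of_tendsto' hlim this
    simp only
    linarith
  -- `V` is a fixed point of the Bellman operator, so one more application turns convexity into the
  -- quantitative convexity produced by the queue cost.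
  exact stepConvex_bellman hρ0 hε hV0 hd.2 (fun z => ⟨d z, hd.1 z, hVeq z⟩) a i

/-- The transmission rate and the number of remaining packets are nondecreasing functions of the
queue length. -/
def IsMonotoneRule (d : M.State → Fin (M.S + 1)) : Prop :=
  ∀ a i (q q' : Fin (M.Q + 1)), q ≤ q' → (d (q, a, i) : ℕ) ≤ d (q', a, i) ∧
    (q : ℕ) + d (q', a, i) ≤ q' + d (q, a, i)

/-- Choosing a rate splits `q` into transmitted and remaining packets. Both parts have strictly
convex cost, so `StepConvex.left_le` applies to each of them in the passage from `q` to `q + 1`.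
Strictness makes this hold for every optimal rule, whatever its tie-breaking. -/
theorem isMonotoneRule_of_isOptimal {ρ ε β : ℝ} (hρ0 : 0 < ρ) (hρ1 : ρ < 1) (hε : 0 < ε)
    (hβ : 0 < β) {d : M.State → Fin (M.S + 1)}
    (hd : M.process.IsOptimal ρ (M.cost ε β) d) : IsMonotoneRule d := by
  intro a i
  have hAQ := M.A_le_Q
  set V := M.process.value ρ (M.cost ε β) d
  have hW := stepConvex_continuation hρ0.le (stepConvex_value hρ0.le hρ1 hε.le hβ.le hd) a
  have hP := stepConvex_power (M := M) (ε := ε) i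
  have hmin : ∀ q ≤ M.Q, ∀ s u, s ≤ M.S → u ≤ M.Q - M.A → s + u = q →
      M.power (M.h i) (d (M.clip q, a, i)) + ε * (d (M.clip q, a, i) : ℝ) ^ 2 +
        continuation ρ V a (q - d (M.clip q, a, i)) ≤
      M.power (M.h i) s + ε * (s : ℝ) ^ 2 + continuation ρ V a u := by
    rintro q hq s u hs hu rfl
    have h := hd.2 (M.clip (s + u), a, i) ⟨s, by omega⟩
      ⟨by simp only [clip_coe hq]; omega, by simp only [clip_coe hq]; omega⟩
    rw [DecisionProcess.value_eq hρ0.le hρ1, actionValue_eq, actionValue_eq] at h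
    simp only [clip_coe hq, Nat.add_sub_cancel_left] at h
    linarith
  have hfeas : ∀ q ≤ M.Q, q + M.A ≤ M.Q + d (M.clip q, a, i) ∧ (d (M.clip q, a, i) : ℕ) ≤ q :=
    fun q hq => by
      have h := hd.1 (M.clip q, a, i)
      simpa only [process, Feasible, clip_coe hq] using h
  have step : ∀ q, q + 1 ≤ M.Q → (d (M.clip q, a, i) : ℕ) ≤ d (M.clip (q + 1), a, i) ∧
      q + d (M.clip (q + 1), a, i) ≤ q + 1 + d (M.clip q, a, i) := by
    intro q hq
    obtain ⟨h1, h2⟩ := hfeas q (by omega)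
    obtain ⟨h1', h2'⟩ := hfeas (q + 1) hq
    have hs := (d (M.clip q, a, i)).2
    have hs' := (d (M.clip (q + 1), a, i)).2
    have hm := hmin q (by omega)
    have hm' := hmin (q + 1) hq
    generalize (d (M.clip q, a, i) : ℕ) = s at *
    generalize (d (M.clip (q + 1), a, i) : ℕ) = s' at *
    constructor
    · exact hW.left_le (P := fun s => M.power (M.h i) s + ε * (s : ℝ) ^ 2) (by positivity)
        (u := q - s) (u' := q + 1 - s') (by omega) (by omega)
        (fun v hv hsv => hm s' v (by omega) hv (by omega))
        (fun v hv hsv => hm' s v (by omega) hv (by omega))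
    -- The same exchange argument with the roles of transmitted and remaining packets interchanged.
    · have := hP.left_le (P := continuation ρ V a) (by positivity)
        (u := s) (u' := s') (s := q - s) (s' := q + 1 - s') (by omega) (by omega)
        (fun v hv hsv => by
          have := hm v (q + 1 - s') (by omega) (by omega) (by omega)
          linarith)
        (fun v hv hsv => by
          have := hm' v (q - s) (by omega) (by omega) (by omega)
          linarith)
      omega
  have main : ∀ q q' : ℕ, q ≤ q' → q' ≤ M.Q → (d (M.clip q, a, i) : ℕ) ≤ d (M.clip q', a, i) ∧
      q + d (M.clip q', a, i) ≤ q' + d (M.clip q, a, i) := by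
    intro q q' hqq
    induction q', hqq using Nat.le_induction with
    | base => intro _; omega
    | succ q' _ ih =>
      intro hq'
      have h1 := ih (by omega)
      have h2 := step q' hq'
      omega
  intro q q' hqq
  have h := main q q' hqq (by omega)
  have hc : ∀ q : Fin (M.Q + 1), M.clip q = q := fun q => Fin.ext (clip_coe (by omega))
  rwa [hc, hc] at h

end FadingLink


/-! ### Optimal rules are unichain for discount factors near `1` -/

lemma Matrix.IsClosedClass.subset_of_mem {Z : Type*} [Fintype Z] [DecidableEq Z]
    {P : Matrix Z Z ℝ} (hP : ∀ i j, 0 ≤ P i j) {C K : Set Z} (hC : P.IsClosedClass C)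
    (hK : P.IsClosedSet K) {z : Z} (hz : z ∈ C) (hz' : z ∈ K) : C ⊆ K := fun y hy => by
  obtain ⟨n, hn⟩ := hC.2.2 z hz y hy
  exact hK.mem_of_pow_pos hP hz' hn

namespace FadingLink

variable {M : FadingLink}

lemma kernel_pos_iff {z z' : M.State} {s : Fin (M.S + 1)} :
    0 < M.process.kernel z s z' ↔ 0 < M.gamma z.2.1 z'.2.1 ∧ 0 < M.eta z'.2.2 ∧
      z'.1 = M.nextQueue z.1 s z'.2.1 := by
  have h1 := M.gamma_nonneg z.2.1 z'.2.1
  have h2 := M.eta_nonneg z'.2.2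
  simp only [process]
  constructor
  · intro h
    split_ifs at h with hq
    · rw [mul_one] at h
      exact ⟨h1.lt_of_ne fun h0 => by simp [← h0] at h, h2.lt_of_ne fun h0 => by simp [← h0] at h,
        hq⟩
    · simp at h
  · rintro ⟨h1, h2, h3⟩
    rw [if_pos h3, mul_one]
    positivity

/-- A feasible rate leaves between `0` and `Q - A` packets, so neither truncation is active. -/
lemma nextQueue_coe {q : Fin (M.Q + 1)} {s : Fin (M.S + 1)} (h : M.Feasible q s)
    (a : Fin (M.A + 1)) : (M.nextQueue q s a : ℕ) = q - s + a := by
  have := h.1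
  have := h.2
  have := a.2
  simp only [nextQueue]
  omega

lemma exists_eta_pos (M : FadingLink) : ∃ i, 0 < M.eta i := by
  by_contra! h
  have : ∑ i, M.eta i ≤ 0 := Finset.sum_nonpos fun i _ => h i
  rw [M.eta_sum] at this
  linarith

lemma exists_gamma_pos (a : Fin (M.A + 1)) : ∃ a', 0 < M.gamma a a' := by
  by_contra! h
  have : ∑ i, M.gamma a i ≤ 0 := Finset.sum_nonpos fun i _ => h i
  rw [M.gamma_sum] at this
  linarith

lemma gamma_pow_pos (M : FadingLink) (a a' : Fin (M.A + 1)) : ∃ k > 0, 0 < (M.gamma ^ k) a a' :=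
  (Matrix.isIrreducible_iff_exists_pow_pos M.gamma_nonneg).1 M.gamma_irreducible a a'

lemma exists_gamma_pos_left (a' : Fin (M.A + 1)) : ∃ a, 0 < M.gamma a a' := by
  obtain ⟨k, hk, h⟩ := M.gamma_pow_pos 0 a'
  obtain ⟨k, rfl⟩ : ∃ n, k = n + 1 := ⟨k - 1, by omega⟩
  obtain ⟨l, -, hl⟩ := Matrix.exists_pos_of_pow_succ_pos M.gamma_nonneg h
  exact ⟨l, hl⟩

variable {d : M.State → Fin (M.S + 1)}

lemma next_mem {C : Set M.State} (hC : (M.process.matrix d).IsClosedSet C) {z : M.State}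
    (hz : z ∈ C) {a' : Fin (M.A + 1)} {i' : Fin M.L} (ha : 0 < M.gamma z.2.1 a')
    (hi : 0 < M.eta i') : (M.nextQueue z.1 (d z) a', a', i') ∈ C :=
  hC z hz _ (kernel_pos_iff.2 ⟨ha, hi, rfl⟩)

/-- A closed set of states contains all arrivals and all channel states of positive probability. -/
lemma exists_mem_of_isClosedSet {C : Set M.State} (hC : (M.process.matrix d).IsClosedSet C)
    (hne : C.Nonempty) (a : Fin (M.A + 1)) {i : Fin M.L} (hi : 0 < M.eta i) :
    ∃ q, (q, a, i) ∈ C := by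
  obtain ⟨z, hz⟩ := hne
  have key : ∀ n a, 0 < (M.gamma ^ n) z.2.1 a → ∃ q i, (q, a, i) ∈ C := by
    intro n
    induction n with
    | zero =>
      intro a ha
      by_cases h : z.2.1 = a
      · exact ⟨z.1, z.2.2, by rw [← h]; exact hz⟩
      · simp [h] at ha
    | succ n ih =>
      intro a ha
      obtain ⟨l, hl, hla⟩ := Matrix.exists_pos_of_pow_succ_pos M.gamma_nonneg ha
      obtain ⟨q, i, hq⟩ := ih l hl
      obtain ⟨i', hi'⟩ := M.exists_eta_pos
      exact ⟨_, i', next_mem hC hq hla hi'⟩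
  obtain ⟨k, hk, h⟩ := M.gamma_pow_pos z.2.1 a
  obtain ⟨k, rfl⟩ : ∃ n, k = n + 1 := ⟨k - 1, by omega⟩
  obtain ⟨l, hl, hla⟩ := Matrix.exists_pos_of_pow_succ_pos M.gamma_nonneg h
  obtain ⟨q, i₀, hq⟩ := key k l hl
  exact ⟨_, next_mem hC hq hla hi⟩

/-- The highest rate is not chosen in all states of a closed class. -/
lemma exists_rate_lt (hd : ∀ z, M.Feasible z.1 (d z)) {C : Set M.State}
    (hC : (M.process.matrix d).IsClosedClass C) : ∃ z ∈ C, (d z : ℕ) < M.S := by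
  by_contra! hS
  have hA := M.A_pos
  have hAS := M.A_le_S
  obtain ⟨a, ha⟩ := exists_gamma_pos_left (M := M) 0
  obtain ⟨i, hi⟩ := M.exists_eta_pos
  obtain ⟨q, hq⟩ := exists_mem_of_isClosedSet hC.2.1 hC.1 a hi
  have hq' := next_mem hC.2.1 hq ha hi
  -- At full rate the queue never grows, since `A ≤ S`, and a step without arrivals lowers it by `S
  -- ≥ 1`. The states of `C` up to the lowered level are thus closed, so the class could not return
  -- to `q`.
  have hsub := hC.subset_of_mem (fun i j => M.process.kernel_nonneg _ _ _)
    (K := {x | x ∈ C ∧ x.1 ≤ M.nextQueue q (d (q, a, i)) 0}) ?_ hq' ⟨hq', le_rfl⟩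
  · have h1 : q ≤ M.nextQueue q (d (q, a, i)) 0 := (hsub hq).2
    rw [Fin.le_def, nextQueue_coe (hd (q, a, i))] at h1
    have h2 := hS _ hq
    have h3 : (d (q, a, i) : ℕ) ≤ q := (hd (q, a, i)).2
    simp only [Fin.val_zero] at h1
    omega
  · rintro x ⟨hx, hxq⟩ y hxy
    refine ⟨hC.2.1 x hx y hxy, le_trans ?_ hxq⟩
    rw [(kernel_pos_iff.1 hxy).2.2, Fin.le_def, nextQueue_coe (hd x)]
    have h2 := hS _ hx
    have h3 : (d x : ℕ) ≤ x.1 := (hd x).2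
    have := y.2.1.2
    omega

/-- Two closed classes of a monotone rule are translates of each other. -/
lemma translate_of_isClosedClass (hmono : IsMonotoneRule d) (hd : ∀ z, M.Feasible z.1 (d z))
    {C₁ C₂ : Set M.State} (h₁ : (M.process.matrix d).IsClosedClass C₁)
    (h₂ : (M.process.matrix d).IsClosedClass C₂) {e : ℕ} {z₁ z₂ : M.State} (hz₁ : z₁ ∈ C₁)
    (hz₂ : z₂ ∈ C₂) (hz : z₁.2 = z₂.2) (he : (z₂.1 : ℕ) = z₁.1 + e)
    (hmin : ∀ x ∈ C₁, ∀ y ∈ C₂, x.2 = y.2 → (x.1 : ℕ) ≤ y.1 → (x.1 : ℕ) + e ≤ y.1) {z : M.State}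
    (hzC : z ∈ C₁) : (z.1 : ℕ) + e ≤ M.Q ∧ (M.clip (z.1 + e), z.2) ∈ C₂ ∧
      d (M.clip (z.1 + e), z.2) = d z := by
  -- By monotonicity the queue in `y` receives at least the rate in `x`, without its successor
  -- falling below that of `x`. A strictly larger rate would shrink the gap below its minimum `e`.
  have step : ∀ x ∈ C₁, ∀ y ∈ C₂, x.2 = y.2 → (y.1 : ℕ) = x.1 + e → d y = d x := by
    rintro ⟨qx, a, i⟩ hx ⟨qy, b, j⟩ hy hxy hq
    obtain ⟨rfl, rfl⟩ : a = b ∧ i = j := by simpa using hxy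
    simp only at hq
    obtain ⟨h1, h2⟩ := hmono a i qx qy (by rw [Fin.le_def]; omega)
    obtain ⟨a', ha'⟩ := exists_gamma_pos (M := M) a
    obtain ⟨i', hi'⟩ := M.exists_eta_pos
    have h3 : (d (qx, a, i) : ℕ) ≤ qx := (hd (qx, a, i)).2
    have h4 : (d (qy, a, i) : ℕ) ≤ qy := (hd (qy, a, i)).2
    have := hmin _ (next_mem h₁.2.1 hx ha' hi') _ (next_mem h₂.2.1 hy ha' hi') rfl (by
      rw [nextQueue_coe (hd (qx, a, i)), nextQueue_coe (hd (qy, a, i))]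
      simp only
      omega)
    rw [nextQueue_coe (hd (qx, a, i)), nextQueue_coe (hd (qy, a, i))] at this
    simp only at this
    exact Fin.ext (by omega)
  have hsub := h₁.subset_of_mem (fun i j => M.process.kernel_nonneg _ _ _)
    (K := {x | x ∈ C₁ ∧ ∃ y ∈ C₂, x.2 = y.2 ∧ (y.1 : ℕ) = x.1 + e}) ?_ hz₁
    ⟨hz₁, z₂, hz₂, hz, he⟩
  · obtain ⟨-, y, hy, hzy, hq⟩ := hsub hzC
    have hQ : (z.1 : ℕ) + e ≤ M.Q := by have := y.1.2; omega
    have hy' : (M.clip (z.1 + e), z.2) = y :=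
      Prod.ext (Fin.ext (by rw [clip_coe hQ, hq])) hzy
    rw [hy']
    exact ⟨hQ, hy, step z hzC y hy hzy hq⟩
  · rintro x ⟨hx, y, hy, hxy, hq⟩ ⟨q', a', i'⟩ hxx'
    obtain ⟨h1, h2, h3⟩ := kernel_pos_iff.1 hxx'
    refine ⟨h₁.2.1 x hx _ hxx', (M.nextQueue y.1 (d y) a', a', i'),
      next_mem h₂.2.1 hy (hxy ▸ h1) h2, rfl, ?_⟩
    have h4 : (d x : ℕ) ≤ x.1 := (hd x).2
    simp only at h3 ⊢
    rw [h3, nextQueue_coe (hd x), nextQueue_coe (hd y), step x hx y hy hxy hq]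
    omega

/-- A monotone rule with two closed classes is not optimal if the discount factor is close to `1`:
a single transmission more would lead to a lower queue length forever. -/
lemma not_isOptimal_of_translate {ρ ε β K : ℝ} (hρ0 : 0 ≤ ρ) (hρ1 : ρ < 1) (hε : 0 ≤ ε)
    (hβ : 0 ≤ β)
    (hK : ∀ i, ∀ s < M.S, M.power (M.h i) (s + 1) - M.power (M.h i) s +
      ε * (((s : ℝ) + 1) ^ 2 - (s : ℝ) ^ 2) ≤ K)
    (hKρ : K * (1 - ρ) < ρ * β) (hmono : IsMonotoneRule d)
    {C₁ C₂ : Set M.State} (h₁ : (M.process.matrix d).IsClosedClass C₁) {e : ℕ} (he : 0 < e)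
    (htrans : ∀ z ∈ C₁, (z.1 : ℕ) + e ≤ M.Q ∧ (M.clip (z.1 + e), z.2) ∈ C₂ ∧
      d (M.clip (z.1 + e), z.2) = d z) : ¬ M.process.IsOptimal ρ (M.cost ε β) d := by
  intro hopt
  have hd : ∀ z, M.Feasible z.1 (d z) := hopt.1
  set V := M.process.value ρ (M.cost ε β) d with hV
  obtain ⟨e, rfl⟩ : ∃ n, e = n + 1 := ⟨e - 1, by omega⟩
  -- `Δ` is the price of one extra packet at the upper class. Writing the shift as `e + 1` makes the
  -- comparison state the one just below that class.
  set Δ : M.State → ℝ := fun z => V (M.clip (z.1 + (e + 1)), z.2) - V (M.clip (z.1 + e), z.2)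
    with hΔ
  have hle : ∀ z ∈ C₁, (d z : ℕ) ≤ z.1 := fun z _ => (hd z).2
  have hcont : ∀ z ∈ C₁, ∀ m : ℝ, (∀ x ∈ C₁, m ≤ Δ x) →
      ρ * m ≤ continuation ρ V z.2.1 (z.1 + (e + 1) - d z) -
        continuation ρ V z.2.1 (z.1 + e - d z) := by
    intro z hz m hm
    have h1 : ∑ a', ∑ i', M.gamma z.2.1 a' * M.eta i' * m = m := by
      simp [← Finset.sum_mul, ← Finset.mul_sum, M.eta_sum, M.gamma_sum]
    simp only [continuation]
    rw [← mul_sub]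
    refine mul_le_mul_of_nonneg_left ?_ hρ0
    rw [← h1]
    simp only [← Finset.sum_sub_distrib]
    refine Finset.sum_le_sum fun a' _ => Finset.sum_le_sum fun i' _ => ?_
    rw [← mul_sub]
    rcases (M.gamma_nonneg z.2.1 a').eq_or_lt with h0 | hpos
    · simp [← h0]
    rcases (M.eta_nonneg i').eq_or_lt with h0 | hpos'
    · simp [← h0]
    refine mul_le_mul_of_nonneg_left ?_ (by positivity)
    have := hm _ (next_mem h₁.2.1 hz hpos hpos')
    simp only [hΔ] at this
    rw [nextQueue_coe (hd z)] at this
    have h2 := hle z hz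
    rwa [show (z.1 : ℕ) - d z + a' + (e + 1) = z.1 + (e + 1) - d z + a' by omega,
      show (z.1 : ℕ) - d z + a' + e = z.1 + e - d z + a' by omega] at this
  have hVy : ∀ z ∈ C₁, V (M.clip (z.1 + (e + 1)), z.2) =
      M.power (M.h z.2.2) (d z) + ε * (d z : ℝ) ^ 2 +
        continuation ρ V z.2.1 (z.1 + (e + 1) - d z) +
        β * (((z.1 + (e + 1) : ℕ) : ℝ) + ε * ((z.1 + (e + 1) : ℕ) : ℝ) ^ 2) := by
    intro z hz
    obtain ⟨hQ, -, hdz⟩ := htrans z hz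
    rw [hV, DecisionProcess.value_eq hρ0 hρ1, actionValue_eq, hdz]
    simp only [clip_coe hQ]
  have hVx : ∀ z ∈ C₁, V (M.clip (z.1 + e), z.2) =
      M.power (M.h z.2.2) (d z) + ε * (d z : ℝ) ^ 2 + continuation ρ V z.2.1 (z.1 + e - d z) +
        β * (((z.1 + e : ℕ) : ℝ) + ε * ((z.1 + e : ℕ) : ℝ) ^ 2) := by
    intro z hz
    obtain ⟨hQ, -, hdz⟩ := htrans z hz
    have hQ' : (z.1 : ℕ) + e ≤ M.Q := by omega
    -- The queue length lies between two at which the rate is `d z`, so monotonicity forces the same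
    -- rate.
    have hdx : d (M.clip (z.1 + e), z.2) = d z := by
      have h1 := (hmono z.2.1 z.2.2 z.1 (M.clip (z.1 + e))
        (by rw [Fin.le_def, clip_coe hQ']; omega)).1
      have h2 := (hmono z.2.1 z.2.2 (M.clip (z.1 + e)) (M.clip (z.1 + (e + 1)))
        (by rw [Fin.le_def, clip_coe hQ', clip_coe hQ]; omega)).1
      have h3 := congr_arg Fin.val hdz
      exact Fin.ext (le_antisymm (h2.trans h3.le) h1)
    rw [hV, DecisionProcess.value_eq hρ0 hρ1, actionValue_eq, hdx]
    simp only [clip_coe hQ']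
  -- With equal rates the extra packet is never sent and costs at least `β` per slot. At a minimizer
  -- of `Δ` this gives `Δ ≥ β + ρ Δ`.
  have hΔβ : ∀ z ∈ C₁, β ≤ (1 - ρ) * Δ z := by
    obtain ⟨z, hz, hmin⟩ := Set.exists_min_image C₁ Δ (Set.toFinite _) h₁.1
    have h1 := hcont z hz (Δ z) hmin
    have h2 : Δ z = _ - _ := rfl
    rw [hVy z hz, hVx z hz] at h2
    have h3 : β * (((z.1 + e : ℕ) : ℝ) + ε * ((z.1 + e : ℕ) : ℝ) ^ 2) + β ≤
        β * (((z.1 + (e + 1) : ℕ) : ℝ) + ε * ((z.1 + (e + 1) : ℕ) : ℝ) ^ 2) := by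
      have : 0 ≤ β * ε * (2 * ((z.1 + e : ℕ) : ℝ) + 1) := by positivity
      push_cast at this ⊢
      linarith
    intro x hx
    have := mul_le_mul_of_nonneg_left (hmin x hx) (by linarith : 0 ≤ 1 - ρ)
    linarith
  obtain ⟨z, hz, hlt⟩ := exists_rate_lt hd h₁
  obtain ⟨hQ, -, hdz⟩ := htrans z hz
  have hfeas : M.Feasible (M.clip (z.1 + (e + 1))) ⟨d z + 1, by omega⟩ := by
    have h1 := hd (M.clip (z.1 + (e + 1)), z.2)
    rw [hdz] at h1
    have h2 := hle z hz
    have h3 := h1.1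
    simp only [clip_coe hQ] at h3
    constructor
    · simp only [clip_coe hQ]; omega
    · simp only [clip_coe hQ]; omega
  -- Sending one packet more costs at most `K` once and saves at least `ρ * β / (1 - ρ)`, contrary
  -- to `hKρ`.
  have h1 := hopt.2 (M.clip (z.1 + (e + 1)), z.2) _ hfeas
  rw [← hV, hVy z hz, actionValue_eq] at h1
  simp only [clip_coe hQ] at h1
  rw [show (z.1 : ℕ) + (e + 1) - (d z + 1) = z.1 + e - d z by omega] at h1
  have h2 := hcont z hz (β / (1 - ρ)) fun x hx => by
    rw [div_le_iff₀ (by linarith), mul_comm]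
    exact hΔβ x hx
  have h3 := hK z.2.2 (d z) hlt
  have h4 : ρ * (β / (1 - ρ)) ≤ K := by
    push_cast at h1
    linarith
  rw [← mul_div_assoc, div_le_iff₀ (by linarith)] at h4
  linarith

/-- Optimal rules for a discount factor close to `1` are unichain. -/
theorem unichain_of_isOptimal {ρ ε β K : ℝ} (hρ0 : 0 < ρ) (hρ1 : ρ < 1) (hε : 0 < ε)
    (hβ : 0 < β)
    (hK : ∀ i, ∀ s < M.S, M.power (M.h i) (s + 1) - M.power (M.h i) s +
      ε * (((s : ℝ) + 1) ^ 2 - (s : ℝ) ^ 2) ≤ K)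
    (hKρ : K * (1 - ρ) < ρ * β) (hopt : M.process.IsOptimal ρ (M.cost ε β) d) :
    ∃! C, (M.process.matrix d).IsClosedClass C := by
  have hmono := isMonotoneRule_of_isOptimal hρ0 hρ1 hε hβ hopt
  have hd : ∀ z, M.Feasible z.1 (d z) := hopt.1
  have hnn : ∀ i j, 0 ≤ M.process.matrix d i j := (M.process.matrix_mem d).1
  obtain ⟨i, hi⟩ := M.exists_eta_pos
  obtain ⟨C, -, hC⟩ := Matrix.exists_isClosedClass_subset hnn ⟨(0, 0, i), trivial⟩
    (K := Set.univ) fun _ _ _ _ => trivial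
  refine ⟨C, hC, fun C' hC' => ?_⟩
  by_contra hne
  have hdisj : ∀ z ∈ C, z ∉ C' := fun z hz hz' => hne <|
    (hC'.subset_of_mem hnn hC.2.1 hz' hz).antisymm (hC.subset_of_mem hnn hC'.2.1 hz hz')
  have main : ∀ C₁ C₂ : Set M.State, (M.process.matrix d).IsClosedClass C₁ →
      (M.process.matrix d).IsClosedClass C₂ → ∀ x ∈ C₁, ∀ y ∈ C₂, x.2 = y.2 →
      (x.1 : ℕ) < y.1 → (∀ x' ∈ C₁, ∀ y' ∈ C₂, x'.2 = y'.2 → (x'.1 : ℕ) ≤ y'.1 →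
        (x.1 : ℕ) + (y'.1 - x'.1) ≥ y.1) → False := by
    intro C₁ C₂ h₁ h₂ x hx y hy hxy hlt hmin
    refine not_isOptimal_of_translate (C₂ := C₂) hρ0.le hρ1 hε.le hβ.le hK hKρ hmono h₁
      (e := y.1 - x.1) (by omega) (fun z hz => ?_) hopt
    refine translate_of_isClosedClass hmono hd h₁ h₂ hx hy hxy (by omega) ?_ hz
    intro x' hx' y' hy' hxy' hle
    have := hmin x' hx' y' hy' hxy' hle
    omega
  obtain ⟨q, hq⟩ := exists_mem_of_isClosedSet hC.2.1 hC.1 0 hi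
  obtain ⟨q', hq'⟩ := exists_mem_of_isClosedSet hC'.2.1 hC'.1 0 hi
  -- A closest pair with equal arrivals and channel state; the two truncated differences add up to
  -- the distance of the queue lengths.
  obtain ⟨⟨x, y⟩, ⟨hx, hy, hxy⟩, hmin⟩ := Set.exists_min_image
    {p : M.State × M.State | p.1 ∈ C ∧ p.2 ∈ C' ∧ p.1.2 = p.2.2}
    (fun p => ((p.1.1 : ℕ) - p.2.1) + ((p.2.1 : ℕ) - p.1.1)) (Set.toFinite _)
    ⟨((q, 0, i), (q', 0, i)), hq, hq', rfl⟩
  simp only at hx hy hxy hmin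
  have hneq : (x.1 : ℕ) ≠ y.1 := fun h => hdisj x hx <| by
    rwa [show x = y from Prod.ext (Fin.ext h) hxy]
  rcases lt_or_gt_of_ne hneq with hlt | hlt
  · refine main C C' hC hC' x hx y hy hxy hlt fun x' hx' y' hy' h hle => ?_
    have := hmin (x', y') ⟨hx', hy', h⟩
    simp only at this
    omega
  · refine main C' C hC' hC y hy x hx hxy.symm hlt fun x' hx' y' hy' h hle => ?_
    have := hmin (y', x') ⟨hy', hx', h.symm⟩
    simp only at this
    omega

end FadingLink


/-! ### Long-term averages of policies and the vanishing discount limit -/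

namespace FadingLink

variable {M : FadingLink}

lemma gamma_mem (M : FadingLink) : M.gamma ∈ Matrix.rowStochastic ℝ (Fin (M.A + 1)) :=
  Matrix.mem_rowStochastic_iff_sum.2 ⟨M.gamma_nonneg, M.gamma_sum⟩

lemma isStationary_phi (M : FadingLink) : M.gamma.IsStationary M.phi :=
  ⟨M.phi_nonneg, M.phi_sum, funext M.phi_stationary⟩

/-- By irreducibility the stationary distribution charges the arrival number `A`, which is positive.
-/
lemma alpha_pos (M : FadingLink) : 0 < M.alpha := by
  have hpow : ∀ n, Matrix.vecMul M.phi (M.gamma ^ n) = M.phi := fun n => by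
    induction n with
    | zero => simp
    | succ n ih => rw [pow_succ, ← Matrix.vecMul_vecMul, ih, M.isStationary_phi.vecMul_eq]
  obtain ⟨b, hb⟩ : ∃ b, 0 < M.phi b := by
    by_contra! h
    have : ∑ a, M.phi a ≤ 0 := Finset.sum_nonpos fun i _ => h i
    rw [M.phi_sum] at this
    linarith
  obtain ⟨k, -, hk⟩ := M.gamma_pow_pos b (Fin.last M.A)
  have hlast : 0 < M.phi (Fin.last M.A) := by
    rw [← hpow k]
    exact Finset.sum_pos' (fun i _ => mul_nonneg (M.phi_nonneg i)
      (Matrix.pow_apply_nonneg M.gamma_nonneg k i _)) ⟨b, Finset.mem_univ b, mul_pos hb hk⟩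
  refine Finset.sum_pos' (fun a _ => mul_nonneg (by positivity) (M.phi_nonneg a))
    ⟨Fin.last M.A, Finset.mem_univ _, mul_pos ?_ hlast⟩
  simpa using M.A_pos

namespace Policy

lemma trans_eq (F : M.Policy) (z z' : M.State) :
    F.trans z z' = ∑ s, F.rate z s * M.process.kernel z s z' := by
  simp only [trans, process, Finset.mul_sum]
  refine Finset.sum_congr rfl fun s _ => ?_
  split_ifs <;> ring

lemma trans_mem (F : M.Policy) : F.trans ∈ Matrix.rowStochastic ℝ M.State := by
  refine Matrix.mem_rowStochastic_iff_sum.2 ⟨fun z z' => ?_, fun z => ?_⟩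
  · rw [trans_eq]
    exact Finset.sum_nonneg fun s _ => mul_nonneg (F.rate_nonneg z s)
      (M.process.kernel_nonneg z s z')
  · simp_rw [trans_eq]
    rw [Finset.sum_comm]
    simp_rw [← Finset.mul_sum, M.process.kernel_sum, mul_one, F.rate_sum]

lemma trans_mulVec (F : M.Policy) (V : M.State → ℝ) (z : M.State) :
    F.trans.mulVec V z = ∑ s, F.rate z s * (M.process.kernel z s ⬝ᵥ V) := by
  simp only [Matrix.mulVec, dotProduct, trans_eq, Finset.sum_mul, Finset.mul_sum, mul_assoc]
  exact Finset.sum_comm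

/-- Expected power in state `z`. -/
def meanPower (F : M.Policy) (z : M.State) : ℝ := ∑ s, F.rate z s * M.power (M.h z.2.2) s

/-- The power-delay pair of the policy in the steady state `π`. -/
def averages (F : M.Policy) (π : M.State → ℝ) : ℝ × ℝ :=
  (π ⬝ᵥ F.meanPower, (1 / M.alpha) * (π ⬝ᵥ fun z => (z.1 : ℝ)))

lemma average_expPower (F : M.Policy) (z : M.State) (N : ℕ) :
    (1 / (N : ℝ)) * ∑ n ∈ Finset.Icc 1 N, F.expPower z n =
      F.trans.cesaro N z ⬝ᵥ F.meanPower := by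
  simp only [expPower, dotProduct, Matrix.cesaro_apply, meanPower]
  rw [Finset.sum_comm, Finset.mul_sum]
  simp_rw [← Finset.sum_mul, ← mul_assoc]

lemma average_expQueue (F : M.Policy) (z : M.State) (N : ℕ) :
    (1 / (N : ℝ)) * ((1 / M.alpha) * ∑ n ∈ Finset.Icc 1 N, F.expQueue z n) =
      (1 / M.alpha) * (F.trans.cesaro N z ⬝ᵥ fun z => (z.1 : ℝ)) := by
  simp only [expQueue, dotProduct, Matrix.cesaro_apply]
  rw [Finset.sum_comm, mul_left_comm, Finset.mul_sum (a := 1 / (N : ℝ))]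
  simp_rw [← Finset.sum_mul, ← mul_assoc]

lemma tendsto_averages (F : M.Policy) (z : M.State) {l : Filter ℕ} {π : M.State → ℝ}
    (h : Tendsto (fun N => F.trans.cesaro N z) l (𝓝 π)) :
    Tendsto (fun N : ℕ => (1 / (N : ℝ)) * ∑ n ∈ Finset.Icc 1 N, F.expPower z n) l
      (𝓝 (F.averages π).1) ∧
    Tendsto (fun N : ℕ => (1 / (N : ℝ)) * ((1 / M.alpha) * ∑ n ∈ Finset.Icc 1 N, F.expQueue z n)) l
      (𝓝 (F.averages π).2) := by
  simp_rw [average_expPower, average_expQueue]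
  exact ⟨((continuous_id.dotProduct continuous_const).tendsto π).comp h,
    (((continuous_id.dotProduct continuous_const).tendsto π).comp h).const_mul _⟩

lemma hasAverages_of_isStationary {F : M.Policy} (hF : F.IsUnichain) {π : M.State → ℝ}
    (hπ : F.trans.IsStationary π) (z : M.State) : F.HasAverages z (F.averages π) :=
  F.tendsto_averages z <| tendsto_pi_nhds.2 fun z' => Matrix.tendsto_cesaro F.trans_mem
    (fun _ hf => Matrix.harmonic_const_of_unichain F.trans_mem hF hf) hπ z z'

/-- No unichain assumption is available here: an ultrafilter limit of the Cesàro row at `z` is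
stationary, and it yields the averages because they converge. -/
lemma HasAverages.exists_isStationary {F : M.Policy} {z : M.State} {x : ℝ × ℝ}
    (h : F.HasAverages z x) : ∃ π, F.trans.IsStationary π ∧ F.averages π = x := by
  obtain ⟨B, hB, hst, -⟩ := Matrix.exists_cesaro_limit F.trans_mem (hyperfilter ℕ)
    Nat.hyperfilter_le_atTop
  have hlim := F.tendsto_averages z (tendsto_pi_nhds.1 hB z)
  exact ⟨B z, hst z, Prod.ext
    (tendsto_nhds_unique hlim.1 (h.1.mono_left Nat.hyperfilter_le_atTop))
    (tendsto_nhds_unique hlim.2 (h.2.mono_left Nat.hyperfilter_le_atTop))⟩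

lemma HasAverages.unique {F : M.Policy} {z : M.State} {x y : ℝ × ℝ}
    (hx : F.HasAverages z x) (hy : F.HasAverages z y) : x = y :=
  Prod.ext (tendsto_nhds_unique hx.1 hy.1) (tendsto_nhds_unique hx.2 hy.2)

/-- The deterministic policy with the given rates. -/
def ofRule (d : M.State → Fin (M.S + 1)) (hd : ∀ z, M.Feasible z.1 (d z)) : M.Policy where
  rate z s := if s = d z then 1 else 0
  rate_nonneg z s := by split_ifs <;> norm_num
  rate_sum z := by simp
  rate_feasible z s hs := if_neg (by rintro rfl; exact hs (hd z))

variable {d d' : M.State → Fin (M.S + 1)} {hd : ∀ z, M.Feasible z.1 (d z)}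
  {hd' : ∀ z, M.Feasible z.1 (d' z)}

lemma ofRule_trans : (ofRule d hd).trans = M.process.matrix d := by
  ext z z'
  simp [trans_eq, ofRule, DecisionProcess.matrix]

lemma ofRule_meanPower (z : M.State) :
    (ofRule d hd).meanPower z = M.power (M.h z.2.2) (d z) := by
  simp [meanPower, ofRule]

lemma ofRule_rate_ne_iff (z : M.State) :
    (ofRule d hd).rate z ≠ (ofRule d' hd').rate z ↔ d z ≠ d' z := by
  refine not_congr ⟨fun h => ?_, fun h => by ext s; simp [ofRule, h]⟩
  have := congr_fun h (d z)
  by_contra hne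
  simp [ofRule, hne] at this

lemma ofRule_differInOneState (h : ∃! z, d z ≠ d' z) :
    (ofRule d hd).DifferInOneState (ofRule d' hd') := by
  simpa only [DifferInOneState, ofRule_rate_ne_iff] using h

lemma ofRule_isUnichain (h : ∃! C, (M.process.matrix d).IsClosedClass C) :
    (ofRule d hd).IsUnichain := by
  rw [← ofRule_trans (hd := hd)] at h
  exact h

lemma ofRule_obtains (h : ∃! C, (M.process.matrix d).IsClosedClass C) {π : M.State → ℝ}
    (hπ : (M.process.matrix d).IsStationary π) :
    (ofRule d hd).Obtains ((ofRule d hd).averages π) :=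
  ⟨fun z => ⟨d z, by simp [ofRule]⟩, ofRule_isUnichain h,
    hasAverages_of_isStationary (ofRule_isUnichain h) (by rwa [ofRule_trans])⟩

end Policy

open Policy

variable (M) in
/-- The power-delay pairs of all policies in all their steady states. -/
def steadyPairs : Set (ℝ × ℝ) :=
  {x | ∃ (F : M.Policy) (π : M.State → ℝ), F.trans.IsStationary π ∧ F.averages π = x}

lemma obtainable_subset (z : M.State) : M.obtainable z ⊆ M.steadyPairs := by
  rintro x ⟨F, hF⟩
  exact ⟨F, hF.exists_isStationary⟩

lemma mem_steadyPairs_of_obtains {F : M.Policy} {x : ℝ × ℝ} (h : F.Obtains x) :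
    x ∈ M.steadyPairs := by
  obtain ⟨i, -⟩ := M.exists_eta_pos
  exact obtainable_subset (0, 0, i) ⟨F, h.2.2 _⟩

/-- A subsolution of the Bellman equation bounds the average cost of every policy. -/
lemma discounted_bound {ρ : ℝ} {c : M.State → Fin (M.S + 1) → ℝ} {V : M.State → ℝ}
    (hV : ∀ z s, M.Feasible z.1 s → V z ≤ M.process.actionValue ρ c V z s) {F : M.Policy}
    {π : M.State → ℝ} (hπ : F.trans.IsStationary π) :
    (1 - ρ) * (π ⬝ᵥ V) ≤ π ⬝ᵥ fun z => ∑ s, F.rate z s * c z s := by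
  have h1 : ∀ z, V z ≤ ∑ s, F.rate z s * c z s + ρ * F.trans.mulVec V z := fun z => by
    calc V z = ∑ s, F.rate z s * V z := by rw [← Finset.sum_mul, F.rate_sum, one_mul]
      _ ≤ ∑ s, F.rate z s * M.process.actionValue ρ c V z s := by
          refine Finset.sum_le_sum fun s _ => ?_
          by_cases hs : M.Feasible z.1 s
          · exact mul_le_mul_of_nonneg_left (hV z s hs) (F.rate_nonneg z s)
          · simp [F.rate_feasible z s hs]
      _ = _ := by
          rw [trans_mulVec, Finset.mul_sum, ← Finset.sum_add_distrib]
          refine Finset.sum_congr rfl fun s _ => ?_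
          rw [DecisionProcess.actionValue]; ring
  have h2 : π ⬝ᵥ V ≤ π ⬝ᵥ ((fun z => ∑ s, F.rate z s * c z s) + ρ • F.trans.mulVec V) :=
    Finset.sum_le_sum fun z _ => mul_le_mul_of_nonneg_left (h1 z) (hπ.nonneg z)
  rw [dotProduct_add, dotProduct_smul, hπ.dotProduct_mulVec, smul_eq_mul] at h2
  linarith

variable (M) in
/-- No steady state of any policy has a smaller sum of the power and `β` times the delay. -/
def MinimizesWeighted (β : ℝ) (x : ℝ × ℝ) : Prop :=
  ∀ y ∈ M.steadyPairs, x.1 + β * x.2 ≤ y.1 + β * y.2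

variable {d d' : M.State → Fin (M.S + 1)} {l : Filter ℕ} {ρ ε b : ℕ → ℝ} {β : ℝ}

lemma tendsto_cost (hε : Tendsto ε l (𝓝 0)) (hb : Tendsto b l (𝓝 β)) (z : M.State)
    (s : Fin (M.S + 1)) : Tendsto (fun k => M.cost (ε k) (b k) z s) l
      (𝓝 (M.power (M.h z.2.2) s + β * z.1)) := by
  simp only [cost, powerCost, queueCost]
  have := ((tendsto_const_nhds (x := M.power (M.h z.2.2) s)).add
    (hε.mul_const ((s : ℝ) ^ 2))).add
    (hb.mul ((tendsto_const_nhds (x := (z.1 : ℝ))).add (hε.mul_const ((z.1 : ℝ) ^ 2))))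
  simpa using this

/-- Vanishing discount: policies that are optimal for perturbed discounted costs minimize the
average cost. -/
lemma minimizesWeighted_of_isOptimal [l.NeBot] (hρ0 : ∀ k, 0 ≤ ρ k) (hρ1 : ∀ k, ρ k < 1)
    (hρ : Tendsto ρ l (𝓝 1)) (hε : Tendsto ε l (𝓝 0)) (hb : Tendsto b l (𝓝 β))
    {hd : ∀ z, M.Feasible z.1 (d z)} (huni : ∃! C, (M.process.matrix d).IsClosedClass C)
    {π : M.State → ℝ} (hπ : (M.process.matrix d).IsStationary π)
    (hopt : ∀ᶠ k in l, M.process.IsOptimal (ρ k) (M.cost (ε k) (b k)) d) :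
    M.MinimizesWeighted (β * M.alpha) ((ofRule d hd).averages π) := by
  rintro y ⟨F, π', hπ', rfl⟩
  have hlim := fun z => Matrix.tendsto_discounted (M.process.matrix_mem d)
    (fun _ hf => Matrix.harmonic_const_of_unichain (M.process.matrix_mem d) huni hf) hπ hρ0 hρ1 hρ
    (r := fun k z => M.cost (ε k) (b k) z (d z))
    (V := fun k => M.process.value (ρ k) (M.cost (ε k) (b k)) d)
    (tendsto_pi_nhds.2 fun z => tendsto_cost hε hb z (d z))
    (Eventually.of_forall fun k z => DecisionProcess.value_eq (hρ0 k) (hρ1 k) z) z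
  have h1 : Tendsto (fun k => π' ⬝ᵥ
      fun z => (1 - ρ k) * M.process.value (ρ k) (M.cost (ε k) (b k)) d z) l
      (𝓝 (π' ⬝ᵥ fun _ => π ⬝ᵥ fun z => M.power (M.h z.2.2) (d z) + β * z.1)) :=
    ((continuous_const.dotProduct continuous_id).tendsto _).comp (tendsto_pi_nhds.2 hlim)
  have h2 : Tendsto (fun k => π' ⬝ᵥ fun z => ∑ s, F.rate z s * M.cost (ε k) (b k) z s) l
      (𝓝 (π' ⬝ᵥ fun z => ∑ s, F.rate z s * (M.power (M.h z.2.2) s + β * z.1))) :=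
    ((continuous_const.dotProduct continuous_id).tendsto _).comp (tendsto_pi_nhds.2 fun z =>
      tendsto_finsetSum Finset.univ fun s _ => (tendsto_cost hε hb z s).const_mul _)
  have h3 := le_of_tendsto_of_tendsto h1 h2 (hopt.mono fun k hk => by
    have := discounted_bound hk.2 hπ'
    rwa [← smul_eq_mul, ← dotProduct_smul] at this)
  have hα := M.alpha_pos.ne'
  -- Delay is queue length divided by `alpha`, so weight `β` on the queue is weight `β * alpha` on
  -- the delay.
  have hα' : ∀ t : ℝ, β * M.alpha * (1 / M.alpha * t) = β * t := fun t => by field_simp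
  have h4 : (π' ⬝ᵥ fun _ => π ⬝ᵥ fun z => M.power (M.h z.2.2) (d z) + β * z.1) =
      π ⬝ᵥ (ofRule d hd).meanPower + β * (π ⬝ᵥ fun z => (z.1 : ℝ)) := by
    rw [dotProduct, ← Finset.sum_mul, hπ'.sum_eq_one, one_mul, ← smul_eq_mul β,
      ← dotProduct_smul, ← dotProduct_add]
    congr 1
    ext z
    simp [ofRule_meanPower]
  have h5 : (π' ⬝ᵥ fun z => ∑ s, F.rate z s * (M.power (M.h z.2.2) s + β * z.1)) =
      π' ⬝ᵥ F.meanPower + β * (π' ⬝ᵥ fun z => (z.1 : ℝ)) := by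
    rw [← smul_eq_mul β, ← dotProduct_smul, ← dotProduct_add]
    congr 1
    ext z
    simp [meanPower, mul_add, Finset.sum_add_distrib, ← Finset.sum_mul, F.rate_sum]
  rw [h4, h5] at h3
  simp only [averages]
  rw [hα', hα']
  exact h3

/-- Vanishing discount: comparison of the delays. -/
lemma averages_snd_le_of_value_le [l.NeBot] (hρ0 : ∀ k, 0 ≤ ρ k) (hρ1 : ∀ k, ρ k < 1)
    (hρ : Tendsto ρ l (𝓝 1)) (hε : Tendsto ε l (𝓝 0))
    {hd : ∀ z, M.Feasible z.1 (d z)} {hd' : ∀ z, M.Feasible z.1 (d' z)}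
    (huni : ∃! C, (M.process.matrix d).IsClosedClass C)
    (huni' : ∃! C, (M.process.matrix d').IsClosedClass C)
    {π π' : M.State → ℝ} (hπ : (M.process.matrix d).IsStationary π)
    (hπ' : (M.process.matrix d').IsStationary π')
    (hle : ∀ᶠ k in l, ∀ z, M.process.value (ρ k) (M.queueCost (ε k)) d' z ≤
      M.process.value (ρ k) (M.queueCost (ε k)) d z) :
    ((ofRule d' hd').averages π').2 ≤ ((ofRule d hd).averages π).2 := by
  have key : ∀ (d : M.State → Fin (M.S + 1)) (π : M.State → ℝ),
      (∃! C, (M.process.matrix d).IsClosedClass C) → (M.process.matrix d).IsStationary π → ∀ z,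
      Tendsto (fun k => (1 - ρ k) * M.process.value (ρ k) (M.queueCost (ε k)) d z) l
        (𝓝 (π ⬝ᵥ fun z => (z.1 : ℝ))) := fun d π huni hπ z =>
    Matrix.tendsto_discounted (M.process.matrix_mem d)
      (fun _ hf => Matrix.harmonic_const_of_unichain (M.process.matrix_mem d) huni hf) hπ hρ0 hρ1
      hρ (r := fun k z => M.queueCost (ε k) z (d z))
      (V := fun k => M.process.value (ρ k) (M.queueCost (ε k)) d)
      (tendsto_pi_nhds.2 fun z => by
        simpa [queueCost] using
          (tendsto_const_nhds (x := (z.1 : ℝ))).add (hε.mul_const ((z.1 : ℝ) ^ 2)))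
      (Eventually.of_forall fun k z => DecisionProcess.value_eq (hρ0 k) (hρ1 k) z) z
  obtain ⟨i, -⟩ := M.exists_eta_pos
  have h := le_of_tendsto_of_tendsto (key d' π' huni' hπ' (0, 0, i)) (key d π huni hπ (0, 0, i))
    (hle.mono fun k hk => mul_le_mul_of_nonneg_left (hk _) (by linarith [hρ1 k]))
  exact mul_le_mul_of_nonneg_left h (one_div_nonneg.2 M.alpha_pos.le)

end FadingLink


/-! ### Chains of minimizers through one-state changes -/

namespace FadingLink

open Policy

variable {M : FadingLink}

variable (M) in
/-- The power-delay pairs of the deterministic unichain policies given by rules. -/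
def rulePairs : Set (ℝ × ℝ) :=
  {x | ∃ (d : M.State → Fin (M.S + 1)) (hd : ∀ z, M.Feasible z.1 (d z)), (ofRule d hd).Obtains x}

lemma Policy.Obtains.unique {F : M.Policy} {x y : ℝ × ℝ} (hx : F.Obtains x) (hy : F.Obtains y) :
    x = y := by
  obtain ⟨i, -⟩ := M.exists_eta_pos
  exact (hx.2.2 (0, 0, i)).unique (hy.2.2 _)

/-- Each of the finitely many rules obtains at most one pair. Finiteness lets an ultrafilter fix the
end points while the weights go to their limits. -/
lemma finite_rulePairs : M.rulePairs.Finite := by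
  have : M.rulePairs = ⋃ d : M.State → Fin (M.S + 1),
      {x | ∃ hd : ∀ z, M.Feasible z.1 (d z), (ofRule d hd).Obtains x} := by
    ext x; simp [rulePairs]
  rw [this]
  refine Set.finite_iUnion fun d => Set.Subsingleton.finite ?_
  rintro x ⟨hd, hx⟩ y ⟨hd', hy⟩
  exact hx.unique hy

variable (M) in
/-- Two pairs, minimizing the same weighted sum of power and delay, that are obtained by
deterministic unichain policies differing in one state; the second has no larger delay. -/
def Linked (x x' : ℝ × ℝ) : Prop :=
  ∃ F F' : M.Policy, F.Obtains x ∧ F'.Obtains x' ∧ F.DifferInOneState F' ∧ x'.2 ≤ x.2 ∧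
    ∃ β > 0, M.MinimizesWeighted β x ∧ M.MinimizesWeighted β x'

lemma exists_increment_bound (M : FadingLink) : ∃ K : ℝ, ∀ i, ∀ s < M.S, ∀ ε ∈ Set.Icc (0 : ℝ) 1,
    M.power (M.h i) (s + 1) - M.power (M.h i) s +
      ε * (((s : ℝ) + 1) ^ 2 - (s : ℝ) ^ 2) ≤ K := by
  obtain ⟨K, hK⟩ := (Set.finite_range fun p : Fin M.L × Fin M.S =>
    M.power (M.h p.1) (p.2 + 1) - M.power (M.h p.1) p.2 +
      (((p.2 : ℝ) + 1) ^ 2 - (p.2 : ℝ) ^ 2)).bddAbove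
  refine ⟨K, fun i s hs ε hε => le_trans ?_ (hK ⟨(i, ⟨s, hs⟩), rfl⟩)⟩
  have : 0 ≤ ((s : ℝ) + 1) ^ 2 - (s : ℝ) ^ 2 := by ring_nf; positivity
  simp only
  linarith [mul_le_of_le_one_left this hε.2]

/-- For two weights of the delay, there are minimizers connected by a chain of one-state changes
through policies that minimize for weights in between. -/
theorem exists_linked_chain {β₀ β₁ : ℝ} (hβ₀ : 0 < β₀) (hβ : β₀ ≤ β₁) :
    ∃ x₀ ∈ M.rulePairs, ∃ x₁ ∈ M.rulePairs, M.MinimizesWeighted (β₀ * M.alpha) x₀ ∧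
      M.MinimizesWeighted (β₁ * M.alpha) x₁ ∧ Relation.ReflTransGen M.Linked x₀ x₁ := by
  set U := hyperfilter ℕ
  have hU : (U : Filter ℕ) ≤ atTop := Nat.hyperfilter_le_atTop
  set ε : ℕ → ℝ := fun k => 1 / ((k : ℝ) + 1) with hεdef
  -- The shift by `2` keeps `ρ 0` strictly positive.
  set ρ : ℕ → ℝ := fun k => 1 - 1 / ((k : ℝ) + 2) with hρdef
  have hε0 : ∀ k, 0 < ε k := fun k => by positivity
  have hε1 : ∀ k, ε k ≤ 1 := fun k => by
    simp only [hεdef]; rw [div_le_one (by positivity)]; linarith [Nat.cast_nonneg (α := ℝ) k]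
  have hρ0 : ∀ k, 0 < ρ k := fun k => by
    simp only [hρdef]; rw [sub_pos, div_lt_one (by positivity)]
    linarith [Nat.cast_nonneg (α := ℝ) k]
  have hρ1 : ∀ k, ρ k < 1 := fun k => by simp only [hρdef]; rw [sub_lt_self_iff]; positivity
  have hε : Tendsto ε U (𝓝 0) := tendsto_one_div_add_atTop_nhds_zero_nat.mono_left hU
  have hρ : Tendsto ρ atTop (𝓝 1) := by
    have h : Tendsto (fun k : ℕ => 1 / ((k : ℝ) + 2)) atTop (𝓝 0) := by
      have := (tendsto_one_div_add_atTop_nhds_zero_nat (𝕜 := ℝ)).comp (tendsto_add_atTop_nat 1)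
      refine this.congr fun k => ?_
      simp only [Function.comp]; push_cast; ring
    simpa only [sub_zero] using tendsto_const_nhds (x := (1 : ℝ)).sub h
  obtain ⟨K, hK⟩ := M.exists_increment_bound
  have huni : ∀ᶠ k in (U : Filter ℕ), ∀ b ∈ Set.Icc β₀ β₁, ∀ d,
      M.process.IsOptimal (ρ k) (M.cost (ε k) b) d →
        ∃! C, (M.process.matrix d).IsClosedClass C := by
    -- The limit is `-β₀ < 0`, so the unichain condition holds for all weights `b ≥ β₀`
    -- simultaneously.
    have h1 : Tendsto (fun k => K * (1 - ρ k) - ρ k * β₀) atTop (𝓝 (K * (1 - 1) - 1 * β₀)) :=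
      ((tendsto_const_nhds.sub hρ).const_mul K).sub (hρ.mul_const β₀)
    filter_upwards [hU (h1.eventually (eventually_lt_nhds (b := 0) (by linarith)))]
      with k hk b hb d hd
    refine unichain_of_isOptimal (hρ0 k) (hρ1 k) (hε0 k) (hβ₀.trans_le hb.1)
      (fun i s hs => hK i s hs (ε k) ⟨(hε0 k).le, hε1 k⟩) ?_ hd
    linarith [mul_le_mul_of_nonneg_left hb.1 (hρ0 k).le]
  have hlim : ∀ (d : M.State → Fin (M.S + 1)) (b : ℕ → ℝ), (∀ k, b k ∈ Set.Icc β₀ β₁) →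
      (∀ᶠ k in (U : Filter ℕ), M.process.IsOptimal (ρ k) (M.cost (ε k) (b k)) d) →
      (∀ z, M.Feasible z.1 (d z)) ∧ (∃! C, (M.process.matrix d).IsClosedClass C) ∧
        ∃ π, (M.process.matrix d).IsStationary π := by
    intro d b hb hopt
    obtain ⟨k, hk, hku⟩ := (hopt.and huni).exists
    obtain ⟨i, -⟩ := M.exists_eta_pos
    have : Nonempty M.State := ⟨(0, 0, i)⟩
    exact ⟨hk.1, hku _ (hb k) d hk, Matrix.exists_isStationary (M.process.matrix_mem d)⟩
  have hend : ∀ (d : M.State → Fin (M.S + 1)), ∀ b ∈ Set.Icc β₀ β₁,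
      (∀ᶠ k in (U : Filter ℕ), M.process.IsOptimal (ρ k) (M.cost (ε k) b) d) →
      ∃ (hd : ∀ z, M.Feasible z.1 (d z)) (x : ℝ × ℝ), (ofRule d hd).Obtains x ∧
        M.MinimizesWeighted (b * M.alpha) x := by
    intro d b hb hopt
    obtain ⟨hd, hu, π, hπ⟩ := hlim d (fun _ => b) (fun _ => hb) hopt
    exact ⟨hd, _, ofRule_obtains hu hπ, minimizesWeighted_of_isOptimal (fun k => (hρ0 k).le) hρ1
      (hρ.mono_left hU) hε tendsto_const_nhds hu hπ hopt⟩
  -- The adjacency relation is part of the witness: rules, and relations between them, are finite in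
  -- number, so the ultrafilter fixes both end rules and the relation at once, hence one path for
  -- almost all `k`.
  have hchain : ∀ᶠ k in (U : Filter ℕ), ∃ p : (M.State → Fin (M.S + 1)) ×
      (M.State → Fin (M.S + 1)) × ((M.State → Fin (M.S + 1)) → (M.State → Fin (M.S + 1)) → Prop),
      M.process.IsOptimal (ρ k) (M.cost (ε k) β₀) p.1 ∧
      M.process.IsOptimal (ρ k) (M.cost (ε k) β₁) p.2.1 ∧
      p.2.2 = M.process.Adjacent (ρ k) (M.powerCost (ε k)) (M.queueCost (ε k)) β₀ β₁ ∧
      Relation.ReflTransGen p.2.2 p.1 p.2.1 := Eventually.of_forall fun k => by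
    obtain ⟨d₀, h₀⟩ := M.process.exists_isOptimal (hρ0 k).le (hρ1 k) (M.cost (ε k) β₀)
    obtain ⟨d₁, h₁, h⟩ := DecisionProcess.exists_chain (hρ0 k).le (hρ1 k) hβ h₀
    exact ⟨(d₀, d₁, _), h₀, h₁, rfl, h⟩
  rw [Ultrafilter.eventually_exists_iff] at hchain
  obtain ⟨⟨d₀, d₁, R⟩, hp⟩ := hchain
  obtain ⟨hd₀, x₀, hx₀, hw₀⟩ := hend d₀ β₀ ⟨le_rfl, hβ⟩ (hp.mono fun k h => h.1)
  obtain ⟨hd₁, x₁, hx₁, hw₁⟩ := hend d₁ β₁ ⟨hβ, le_rfl⟩ (hp.mono fun k h => h.2.1)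
  have hR : ∀ᶠ k in (U : Filter ℕ),
      R = M.process.Adjacent (ρ k) (M.powerCost (ε k)) (M.queueCost (ε k)) β₀ β₁ :=
    hp.mono fun k h => h.2.2.1
  have hpath : Relation.ReflTransGen R d₀ d₁ := hp.exists.choose_spec.2.2.2
  have hlink : ∀ d d', R d d' → ∃ (hd : ∀ z, M.Feasible z.1 (d z))
      (hd' : ∀ z, M.Feasible z.1 (d' z)) (x x' : ℝ × ℝ), (ofRule d hd).Obtains x ∧
        (ofRule d' hd').Obtains x' ∧ M.Linked x x' := by
    intro d d' hdd
    have hadj : ∀ᶠ k in (U : Filter ℕ),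
        M.process.Adjacent (ρ k) (M.powerCost (ε k)) (M.queueCost (ε k)) β₀ β₁ d d' :=
      hR.mono fun k h => h ▸ hdd
    -- The weight at which both rules are optimal depends on `k`; `β₀` is a dummy value for the
    -- negligible `k` without adjacency.
    have hb : ∀ k, ∃ b ∈ Set.Icc β₀ β₁,
        M.process.Adjacent (ρ k) (M.powerCost (ε k)) (M.queueCost (ε k)) β₀ β₁ d d' →
        M.process.IsOptimal (ρ k) (M.cost (ε k) b) d ∧
          M.process.IsOptimal (ρ k) (M.cost (ε k) b) d' := fun k => by
      by_cases h : M.process.Adjacent (ρ k) (M.powerCost (ε k)) (M.queueCost (ε k)) β₀ β₁ d d'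
      · obtain ⟨b, hb, h'⟩ := h.2.2
        exact ⟨b, hb, fun _ => h'⟩
      · exact ⟨β₀, ⟨le_rfl, hβ⟩, fun h' => absurd h' h⟩
    choose b hb hopt using hb
    have ho := hadj.mono fun k h => (hopt k h).1
    have ho' := hadj.mono fun k h => (hopt k h).2
    obtain ⟨hd, hu, π, hπ⟩ := hlim d b hb ho
    obtain ⟨hd', hu', π', hπ'⟩ := hlim d' b hb ho'
    obtain ⟨β, hβmem, hβlim⟩ := isCompact_Icc.ultrafilter_le_nhds (U.map b) (by
      rw [Ultrafilter.coe_map, le_principal_iff, mem_map]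
      exact Eventually.of_forall hb)
    have hβlim : Tendsto b U (𝓝 β) := hβlim
    exact ⟨hd, hd', _, _, ofRule_obtains hu hπ, ofRule_obtains hu' hπ', ofRule d hd, ofRule d' hd',
      ofRule_obtains hu hπ, ofRule_obtains hu' hπ',
      ofRule_differInOneState hadj.exists.choose_spec.1,
      averages_snd_le_of_value_le (fun k => (hρ0 k).le) hρ1 (hρ.mono_left hU) hε hu hu' hπ hπ'
        (hadj.mono fun k h => h.2.1),
      β * M.alpha, mul_pos (hβ₀.trans_le hβmem.1) M.alpha_pos,
      minimizesWeighted_of_isOptimal (fun k => (hρ0 k).le) hρ1 (hρ.mono_left hU) hε hβlim hu hπ ho,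
      minimizesWeighted_of_isOptimal (fun k => (hρ0 k).le) hρ1 (hρ.mono_left hU) hε hβlim hu' hπ'
        ho'⟩
  refine ⟨x₀, ⟨d₀, hd₀, hx₀⟩, x₁, ⟨d₁, hd₁, hx₁⟩, hw₀, hw₁, ?_⟩
  clear hw₁ hp
  induction hpath generalizing x₁ with
  | refl => rw [hx₀.unique hx₁]
  | tail _ hstep ih =>
    obtain ⟨hd, hd', x, x', hx, hx', hxx'⟩ := hlink _ _ hstep
    rw [hx₁.unique hx']
    exact (ih hd x hx).tail hxx'

/-- The chain of the preceding theorem can start at minimal power and end at minimal delay. -/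
theorem exists_full_chain (M : FadingLink) :
    ∃ x₀ ∈ M.rulePairs, ∃ x₁ ∈ M.rulePairs,
      (∀ y ∈ M.steadyPairs, x₀.1 ≤ y.1) ∧ (∀ y ∈ M.steadyPairs, x₁.2 ≤ y.2) ∧
      (∃ β > 0, M.MinimizesWeighted β x₁) ∧
      Relation.ReflTransGen M.Linked x₀ x₁ := by
  have hα := M.alpha_pos
  -- The weights `1 / (m + 1)` and `m + 1` isolate power and delay, respectively, as `m` grows.
  have hex : ∀ᶠ m : ℕ in hyperfilter ℕ, ∃ p : M.rulePairs × M.rulePairs,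
      M.MinimizesWeighted (1 / ((m : ℝ) + 1) * M.alpha) p.1 ∧
      M.MinimizesWeighted (((m : ℝ) + 1) * M.alpha) p.2 ∧
      Relation.ReflTransGen M.Linked p.1 p.2 := Eventually.of_forall fun m => by
    obtain ⟨x₀, h₀, x₁, h₁, h⟩ := exists_linked_chain (M := M) (β₀ := 1 / ((m : ℝ) + 1))
      (β₁ := (m : ℝ) + 1) (by positivity) (by
        rw [div_le_iff₀ (by positivity)]
        nlinarith [Nat.cast_nonneg (α := ℝ) m])
    exact ⟨(⟨x₀, h₀⟩, ⟨x₁, h₁⟩), h⟩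
  have := finite_rulePairs (M := M).to_subtype
  rw [Ultrafilter.eventually_exists_iff] at hex
  obtain ⟨⟨⟨x₀, h₀⟩, ⟨x₁, h₁⟩⟩, hp⟩ := hex
  have hlim : Tendsto (fun m : ℕ => 1 / ((m : ℝ) + 1) * M.alpha) (hyperfilter ℕ) (𝓝 0) := by
    simpa using ((tendsto_one_div_add_atTop_nhds_zero_nat (𝕜 := ℝ)).mul_const M.alpha).mono_left
      Nat.hyperfilter_le_atTop
  obtain ⟨m, -, hm, hchain⟩ := hp.exists
  have hmin₀ : ∀ y ∈ M.steadyPairs, x₀.1 ≤ y.1 := fun y hy => by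
    have h1 : Tendsto (fun m : ℕ => x₀.1 + 1 / ((m : ℝ) + 1) * M.alpha * x₀.2) (hyperfilter ℕ)
      (𝓝 (x₀.1 + 0 * x₀.2)) := tendsto_const_nhds.add (hlim.mul_const _)
    have h2 : Tendsto (fun m : ℕ => y.1 + 1 / ((m : ℝ) + 1) * M.alpha * y.2) (hyperfilter ℕ)
      (𝓝 (y.1 + 0 * y.2)) := tendsto_const_nhds.add (hlim.mul_const _)
    simpa using le_of_tendsto_of_tendsto h1 h2 (hp.mono fun m h => h.1 y hy)
  have hmin₁ : ∀ y ∈ M.steadyPairs, x₁.2 ≤ y.2 := fun y hy => by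
    have hlim' : Tendsto (fun m : ℕ => 1 / ((m : ℝ) + 1)) (hyperfilter ℕ) (𝓝 0) :=
      (tendsto_one_div_add_atTop_nhds_zero_nat (𝕜 := ℝ)).mono_left Nat.hyperfilter_le_atTop
    have h1 : Tendsto (fun m : ℕ => 1 / ((m : ℝ) + 1) * x₁.1 + M.alpha * x₁.2) (hyperfilter ℕ)
      (𝓝 (0 * x₁.1 + M.alpha * x₁.2)) := (hlim'.mul_const _).add tendsto_const_nhds
    have h2 : Tendsto (fun m : ℕ => 1 / ((m : ℝ) + 1) * y.1 + M.alpha * y.2) (hyperfilter ℕ)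
      (𝓝 (0 * y.1 + M.alpha * y.2)) := (hlim'.mul_const _).add tendsto_const_nhds
    have h3 := le_of_tendsto_of_tendsto h1 h2 (hp.mono fun m h => by
      have h4 := h.2.1 y hy
      have h5 : (0 : ℝ) < (m : ℝ) + 1 := by positivity
      have h6 : ∀ u v : ℝ, 1 / ((m : ℝ) + 1) * u + M.alpha * v =
          1 / ((m : ℝ) + 1) * (u + ((m : ℝ) + 1) * M.alpha * v) := fun u v => by field_simp
      simp only [h6]
      exact mul_le_mul_of_nonneg_left h4 (by positivity))
    simp only [zero_mul, zero_add] at h3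
    exact le_of_mul_le_mul_left h3 hα
  exact ⟨x₀, h₀, x₁, h₁, hmin₀, hmin₁, ⟨_, by positivity, hm⟩, hchain⟩

end FadingLink


/-! ### Mixtures of policies and the segments they obtain -/

/-- A stochastic matrix with more positive entries than a unichain is a unichain. -/
lemma Matrix.unichain_of_pos_imp {Z : Type*} [Fintype Z] [DecidableEq Z] {P P' : Matrix Z Z ℝ}
    (hP : ∀ i j, 0 ≤ P i j) (hP' : ∀ i j, 0 ≤ P' i j) (himp : ∀ i j, 0 < P i j → 0 < P' i j)
    (huni : ∃! C, P.IsClosedClass C) : ∃! C, P'.IsClosedClass C := by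
  have hsub : ∀ C, P'.IsClosedClass C → ∃ C' ⊆ C, P.IsClosedClass C' := fun C hC =>
    exists_isClosedClass_subset hP hC.1 fun z hz z' h => hC.2.1 z hz z' (himp z z' h)
  obtain ⟨C₀, h₀⟩ := huni.exists
  obtain ⟨C, -, hC⟩ := exists_isClosedClass_subset hP' (K := Set.univ)
    (h₀.1.mono (Set.subset_univ _)) fun _ _ _ _ => trivial
  refine ⟨C, hC, fun C' hC' => ?_⟩
  -- Each closed class of `P'` contains a closed class of `P`, of which there is only one. So any
  -- two of them meet and therefore coincide.
  obtain ⟨B, hBC, hB⟩ := hsub C hC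
  obtain ⟨B', hBC', hB'⟩ := hsub C' hC'
  obtain ⟨z, hz⟩ := hB.1
  have hz' : z ∈ C' := by
    rw [huni.unique hB hB'] at hz
    exact hBC' hz
  exact (hC'.subset_of_mem hP' hC.2.1 hz' (hBC hz)).antisymm
    (hC.subset_of_mem hP' hC'.2.1 (hBC hz) hz')

namespace FadingLink

open Policy

variable {M : FadingLink}

namespace Policy

/-- In every state, use `F` with probability `1 - θ` and `F'` with probability `θ`. -/
def mix (F F' : M.Policy) (θ : ℝ) (h0 : 0 ≤ θ) (h1 : θ ≤ 1) : M.Policy where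
  rate z s := (1 - θ) * F.rate z s + θ * F'.rate z s
  rate_nonneg z s := add_nonneg (mul_nonneg (by linarith) (F.rate_nonneg z s))
    (mul_nonneg h0 (F'.rate_nonneg z s))
  rate_sum z := by
    rw [Finset.sum_add_distrib, ← Finset.mul_sum, ← Finset.mul_sum, F.rate_sum, F'.rate_sum]
    ring
  rate_feasible z s hs := by rw [F.rate_feasible z s hs, F'.rate_feasible z s hs]; ring

variable {F F' : M.Policy} {θ : ℝ} {h0 : 0 ≤ θ} {h1 : θ ≤ 1}

lemma mix_trans (z z' : M.State) :
    (F.mix F' θ h0 h1).trans z z' = (1 - θ) * F.trans z z' + θ * F'.trans z z' := by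
  simp only [trans_eq, mix, Finset.mul_sum, ← Finset.sum_add_distrib]
  exact Finset.sum_congr rfl fun s _ => by ring

lemma mix_isUnichain (hF : F.IsUnichain) (hF' : F'.IsUnichain) :
    (F.mix F' θ h0 h1).IsUnichain := by
  rcases h1.lt_or_eq with hlt | rfl
  · refine Matrix.unichain_of_pos_imp F.trans_mem.1 (trans_mem _).1 (fun z z' h => ?_) hF
    rw [mix_trans]
    have := F'.trans_mem.1 z z'
    have := mul_pos (sub_pos.2 hlt) h
    positivity
  · refine Matrix.unichain_of_pos_imp F'.trans_mem.1 (trans_mem _).1 (fun z z' h => ?_) hF'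
    rw [mix_trans]
    linarith

/-- Mixtures of two unichain policies that differ in one state obtain all pairs in between. -/
lemma segment_subset_obtainable {x x' : ℝ × ℝ} (hF : F.Obtains x) (hF' : F'.Obtains x')
    (hdiff : F.DifferInOneState F') (z₀ : M.State) : segment ℝ x x' ⊆ M.obtainable z₀ := by
  rintro y ⟨a, t, ha, ht, hat, rfl⟩
  obtain ⟨π, hπ, rfl⟩ := (hF.2.2 z₀).exists_isStationary
  obtain ⟨π', hπ', rfl⟩ := (hF'.2.2 z₀).exists_isStationary
  obtain ⟨y, -, hy⟩ := hdiff
  have hw : 0 ≤ a * π y := mul_nonneg ha (hπ.nonneg y)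
  have hw' : 0 ≤ t * π' y := mul_nonneg ht (hπ'.nonneg y)
  -- `θ` is the share of `π'` in the mass of `y`, so the combined distribution has exactly the
  -- conditional rates of the mixture there. If `y` has no mass, the quotient is `0` and any `θ`
  -- would do.
  have h0 : 0 ≤ t * π' y / (a * π y + t * π' y) := by positivity
  have h1 : t * π' y / (a * π y + t * π' y) ≤ 1 := div_le_one_of_le₀ (by linarith) (by positivity)
  set θ := t * π' y / (a * π y + t * π' y) with hθ
  have hθmul : (a * π y + t * π' y) * θ = t * π' y := by
    rcases eq_or_ne (a * π y + t * π' y) 0 with h | h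
    · rw [h, zero_mul]; linarith
    · rw [hθ]; field_simp
  set G := F.mix F' θ h0 h1
  set ν : M.State → ℝ := fun z => a * π z + t * π' z with hν
  have hrate : ∀ z s, ν z * G.rate z s = a * (π z * F.rate z s) + t * (π' z * F'.rate z s) := by
    intro z s
    by_cases hz : z = y
    · subst hz
      simp only [hν, G, mix]
      linear_combination (F'.rate z s - F.rate z s) * hθmul
    · have : F.rate z = F'.rate z := by
        by_contra h
        exact hz (hy z h)
      simp only [hν, G, mix, this]
      ring
  have hlin : ∀ f : M.State → Fin (M.S + 1) → ℝ,
      ∑ z, ν z * ∑ s, G.rate z s * f z s = a * ∑ z, π z * ∑ s, F.rate z s * f z s +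
        t * ∑ z, π' z * ∑ s, F'.rate z s * f z s := by
    intro f
    simp only [Finset.mul_sum, ← Finset.sum_add_distrib]
    refine Finset.sum_congr rfl fun z _ => Finset.sum_congr rfl fun s _ => ?_
    rw [← mul_assoc, hrate]
    ring
  have hst : G.trans.IsStationary ν := by
    refine ⟨fun z => add_nonneg (mul_nonneg ha (hπ.nonneg z)) (mul_nonneg ht (hπ'.nonneg z)), ?_, ?_⟩
    · simp only [hν, Finset.sum_add_distrib, ← Finset.mul_sum, hπ.sum_eq_one, hπ'.sum_eq_one]
      linarith
    · ext z'
      have h := hlin fun z s => M.process.kernel z s z'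
      have e : ∀ (H : M.Policy) (μ : M.State → ℝ), ∑ z, μ z * ∑ s, H.rate z s *
          M.process.kernel z s z' = Matrix.vecMul μ H.trans z' := fun H μ => by
        simp only [Matrix.vecMul, dotProduct, trans_eq]
      rw [e, e, e, hπ.vecMul_eq, hπ'.vecMul_eq] at h
      exact h
  refine ⟨G, ?_⟩
  have hG : G.averages ν = a • F.averages π + t • F'.averages π' := by
    refine Prod.ext ?_ ?_
    · exact hlin fun z s => M.power (M.h z.2.2) s
    · simp only [averages, Prod.snd_add, Prod.smul_snd, smul_eq_mul]
      rw [show ν = a • π + t • π' from rfl, add_dotProduct, smul_dotProduct, smul_dotProduct,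
        smul_eq_mul, smul_eq_mul]
      ring
  rw [← hG]
  exact hasAverages_of_isStationary (mix_isUnichain hF.2.1 hF'.2.1) hst z₀

end Policy

/-! ### Minimal delay -/

section MinimalDelay

variable {F : M.Policy} {π : M.State → ℝ}

lemma dotProduct_next (hπ : F.trans.IsStationary π) (f : M.State → ℝ) :
    π ⬝ᵥ f = ∑ z, π z * ∑ s, F.rate z s *
      ∑ a', ∑ i', M.gamma z.2.1 a' * M.eta i' * f (M.nextQueue z.1 s a', a', i') := by
  rw [← hπ.dotProduct_mulVec, dotProduct]
  simp only [trans_mulVec, kernel_dotProduct]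

/-- In a steady state, the arrivals and the channel have the distribution `φ ⊗ η`. -/
lemma dotProduct_arrival_channel (hπ : F.trans.IsStationary π) (w : Fin (M.A + 1) → Fin M.L → ℝ) :
    ∑ z, π z * w z.2.1 z.2.2 = ∑ a, ∑ i, M.phi a * M.eta i * w a i := by
  have hnext : ∀ w : Fin (M.A + 1) → Fin M.L → ℝ, ∑ z, π z * w z.2.1 z.2.2 =
      ∑ z, π z * ∑ a', ∑ i', M.gamma z.2.1 a' * M.eta i' * w a' i' := fun w => by
    have := dotProduct_next hπ fun z => w z.2.1 z.2.2
    simp only [dotProduct, ← Finset.sum_mul, F.rate_sum, one_mul] at this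
    exact this
  -- The arrival marginal of `π` is stationary for `gamma`, hence equal to `phi`.
  set m : Fin (M.A + 1) → ℝ := fun a => ∑ z, if z.2.1 = a then π z else 0 with hm
  have hmsum : ∀ u : Fin (M.A + 1) → ℝ, ∑ a, m a * u a = ∑ z, π z * u z.2.1 := fun u => by
    simp only [hm, Finset.sum_mul]
    rw [Finset.sum_comm]
    simp [ite_mul]
  have hst : M.gamma.IsStationary m := by
    refine ⟨fun a => Finset.sum_nonneg fun z _ => ?_, ?_, ?_⟩
    · split_ifs
      · exact hπ.nonneg z
      · rfl
    · have := hmsum fun _ => 1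
      simpa [hπ.sum_eq_one] using this
    · ext a
      have h1 := hnext fun a' _ => if a' = a then 1 else 0
      simp only [mul_ite, mul_one, mul_zero] at h1
      rw [Matrix.vecMul, dotProduct, hmsum]
      simp only [hm]
      rw [h1]
      simp [Finset.sum_ite_irrel, ← Finset.mul_sum, M.eta_sum]
  have hphi : m = M.phi := Matrix.IsStationary.eq M.gamma_mem
    (fun _ hf => Matrix.harmonic_const_of_irreducible M.gamma_mem M.gamma_irreducible hf)
    hst M.isStationary_phi
  rw [hnext, ← hmsum fun a => ∑ a', ∑ i', M.gamma a a' * M.eta i' * w a' i', hphi]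
  simp only [Finset.mul_sum]
  rw [Finset.sum_comm]
  refine Finset.sum_congr rfl fun a' _ => ?_
  rw [Finset.sum_comm]
  refine Finset.sum_congr rfl fun i' _ => ?_
  rw [← M.phi_stationary a', Finset.sum_mul, Finset.sum_mul]
  exact Finset.sum_congr rfl fun a _ => by ring

/-- The average queue length is the average number of packets left after the transmission plus
the average number of arrivals. -/
lemma average_queue (hπ : F.trans.IsStationary π) :
    (π ⬝ᵥ fun z => (z.1 : ℝ)) =
      ∑ z, π z * ∑ s, F.rate z s * ((z.1 : ℝ) - (s : ℝ)) + M.alpha := by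
  have hα : M.alpha = ∑ z, π z * (z.2.1 : ℝ) := by
    rw [dotProduct_arrival_channel hπ fun a _ => (a : ℝ)]
    simp only [← Finset.sum_mul, ← Finset.mul_sum, M.eta_sum, mul_one, alpha]
    exact Finset.sum_congr rfl fun a _ => mul_comm _ _
  have hα' : M.alpha = ∑ z, π z * ∑ a', M.gamma z.2.1 a' * (a' : ℝ) := by
    have h := dotProduct_next hπ fun z => (z.2.1 : ℝ)
    simp only [dotProduct] at h
    rw [hα, h]
    refine Finset.sum_congr rfl fun z _ => ?_
    simp only [← Finset.sum_mul, ← Finset.mul_sum, M.eta_sum, mul_one, F.rate_sum, one_mul]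
  rw [dotProduct_next hπ, hα', ← Finset.sum_add_distrib]
  refine Finset.sum_congr rfl fun z _ => ?_
  rw [← mul_add]
  congr 1
  have : ∑ a', M.gamma z.2.1 a' * (a' : ℝ) =
      ∑ s, F.rate z s * ∑ a', M.gamma z.2.1 a' * (a' : ℝ) := by
    rw [← Finset.sum_mul, F.rate_sum, one_mul]
  rw [this, ← Finset.sum_add_distrib]
  refine Finset.sum_congr rfl fun s _ => ?_
  by_cases hs : M.Feasible z.1 s
  · rw [← mul_add]
    congr 1
    simp only [nextQueue_coe hs]
    rw [← one_mul ((z.1 : ℝ) - s), ← M.gamma_sum z.2.1, Finset.sum_mul, ← Finset.sum_add_distrib]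
    refine Finset.sum_congr rfl fun a' _ => ?_
    rw [← Finset.sum_mul, ← Finset.mul_sum, M.eta_sum]
    push_cast [Nat.cast_sub hs.2]
    ring
  · simp [F.rate_feasible z s hs]

lemma one_le_averages_snd (hπ : F.trans.IsStationary π) : 1 ≤ (F.averages π).2 := by
  have hα := M.alpha_pos
  simp only [averages]
  rw [average_queue hπ, one_div, ← div_eq_inv_mul, le_div_iff₀ hα]
  have : 0 ≤ ∑ z, π z * ∑ s, F.rate z s * ((z.1 : ℝ) - (s : ℝ)) := by
    refine Finset.sum_nonneg fun z _ => mul_nonneg (hπ.nonneg z) (Finset.sum_nonneg fun s _ => ?_)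
    by_cases hs : M.Feasible z.1 s
    · exact mul_nonneg (F.rate_nonneg z s) (sub_nonneg.2 (Nat.cast_le.2 hs.2))
    · simp [F.rate_feasible z s hs]
  linarith

/-- With the minimal delay, all arriving packets are transmitted at once. -/
lemma averages_fst_of_snd_eq_one (hπ : F.trans.IsStationary π) (h : (F.averages π).2 = 1) :
    (F.averages π).1 = ∑ a, ∑ i, M.phi a * M.eta i * M.power (M.h i) a := by
  have hα := M.alpha_pos
  simp only [averages] at h ⊢
  rw [average_queue hπ, one_div, ← div_eq_inv_mul, div_eq_one_iff_eq hα.ne'] at h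
  have hnn : ∀ z s, 0 ≤ F.rate z s * ((z.1 : ℝ) - (s : ℝ)) := fun z s => by
    by_cases hs : M.Feasible z.1 s
    · exact mul_nonneg (F.rate_nonneg z s) (sub_nonneg.2 (Nat.cast_le.2 hs.2))
    · simp [F.rate_feasible z s hs]
  have h0 : ∑ z, π z * ∑ s, F.rate z s * ((z.1 : ℝ) - (s : ℝ)) = 0 := by linarith
  -- Delay `1` means that on average no packets remain after transmission; the terms are
  -- nonnegative, so every rate in use empties the queue.
  have hsupp : ∀ z s, π z ≠ 0 → F.rate z s ≠ 0 → (s : ℕ) = z.1 := by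
    intro z s hz hs
    rw [Finset.sum_eq_zero_iff_of_nonneg fun z _ =>
      mul_nonneg (hπ.nonneg z) (Finset.sum_nonneg fun s _ => hnn z s)] at h0
    have h1 := (mul_eq_zero.1 (h0 z (Finset.mem_univ z))).resolve_left hz
    rw [Finset.sum_eq_zero_iff_of_nonneg fun s _ => hnn z s] at h1
    have h2 := (mul_eq_zero.1 (h1 s (Finset.mem_univ s))).resolve_left hs
    exact_mod_cast (sub_eq_zero.1 h2).symm
  have hreplace : ∀ f g : M.State → Fin (M.S + 1) → ℝ,
      (∀ z (s : Fin (M.S + 1)), (s : ℕ) = z.1 → M.Feasible z.1 s → f z s = g z s) →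
      ∑ z, π z * ∑ s, F.rate z s * f z s = ∑ z, π z * ∑ s, F.rate z s * g z s := by
    intro f g hfg
    refine Finset.sum_congr rfl fun z _ => ?_
    by_cases hz : π z = 0
    · simp [hz]
    congr 1
    refine Finset.sum_congr rfl fun s _ => ?_
    by_cases hs : F.rate z s = 0
    · simp [hs]
    rw [hfg z s (hsupp z s hz hs) (by_contra fun hf => hs (F.rate_feasible z s hf))]
  calc π ⬝ᵥ F.meanPower = ∑ z, π z * ∑ s, F.rate z s * M.power (M.h z.2.2) s := rfl
    _ = ∑ z, π z * ∑ s, F.rate z s * M.power (M.h z.2.2) z.1 :=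
        hreplace _ _ fun z s hs _ => by rw [hs]
    _ = π ⬝ᵥ fun z => M.power (M.h z.2.2) z.1 := by
        simp only [← Finset.sum_mul, F.rate_sum, one_mul, dotProduct]
    _ = _ := dotProduct_next hπ _
    _ = ∑ z, π z * ∑ s, F.rate z s *
          ∑ a', ∑ i', M.gamma z.2.1 a' * M.eta i' * M.power (M.h i') a' := by
        refine hreplace _ _ fun z s hs hf => ?_
        simp only [nextQueue_coe hf, hs, Nat.sub_self, zero_add]
    _ = ∑ z, π z * M.power (M.h z.2.2) z.2.1 := by
        have := dotProduct_next hπ fun z => M.power (M.h z.2.2) z.2.1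
        exact this.symm
    _ = _ := dotProduct_arrival_channel hπ fun a i => M.power (M.h i) a

/-- Transmitting as much as possible leads to the minimal delay. -/
lemma exists_steadyPairs_snd_eq_one (M : FadingLink) : ∃ x ∈ M.steadyPairs, x.2 = 1 := by
  have hAQ := M.A_le_Q
  have hAS := M.A_le_S
  choose d hd using show ∀ z : M.State, ∃ s : Fin (M.S + 1), (s : ℕ) = min (z.1 : ℕ) M.S from
    fun z => ⟨⟨min (z.1 : ℕ) M.S, Nat.lt_succ_of_le (min_le_right _ _)⟩, rfl⟩
  have hfeas : ∀ z : M.State, M.Feasible z.1 (d z) := fun z => by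
    have := z.1.2
    constructor <;> rw [hd] <;> omega
  -- Since `A ≤ S`, a queue of at most `A` packets is emptied in one slot, so in this steady state
  -- the queue length equals the number of new arrivals.
  set π : M.State → ℝ := fun z => if z.1 = M.clip z.2.1 then M.phi z.2.1 * M.eta z.2.2 else 0
    with hπdef
  have hsum : ∀ f : M.State → ℝ,
      ∑ z, π z * f z = ∑ a, ∑ i, M.phi a * M.eta i * f (M.clip a, a, i) := fun f => by
    rw [Fintype.sum_prod_type, Finset.sum_comm]
    simp [hπdef, Fintype.sum_prod_type, ite_mul]
  have hst : (ofRule d hfeas).trans.IsStationary π := by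
    refine ⟨fun z => ?_, ?_, ?_⟩
    · simp only [hπdef]
      split_ifs
      · exact mul_nonneg (M.phi_nonneg _) (M.eta_nonneg _)
      · rfl
    · have := hsum fun _ => 1
      simpa [← Finset.mul_sum, M.eta_sum, M.phi_sum] using this
    · rw [ofRule_trans]
      ext z'
      rw [Matrix.vecMul, dotProduct, hsum]
      have h1 : ∀ (a : Fin (M.A + 1)) (i : Fin M.L),
          M.process.matrix d (M.clip a, a, i) z' =
            M.gamma a z'.2.1 * M.eta z'.2.2 * if z'.1 = M.clip z'.2.1 then 1 else 0 := by
        intro a i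
        have h2 : M.nextQueue (M.clip a) (d (M.clip a, a, i)) z'.2.1 = M.clip z'.2.1 := by
          have ha := a.2
          ext
          simp only [nextQueue, clip, hd]
          omega
        simp only [DecisionProcess.matrix, process, h2]
      simp only [h1, hπdef]
      split_ifs with hz
      · simp only [mul_one]
        rw [← M.phi_stationary z'.2.1, Finset.sum_mul]
        refine Finset.sum_congr rfl fun a _ => ?_
        rw [← Finset.sum_mul, ← Finset.mul_sum, M.eta_sum]
        ring
      · simp
  refine ⟨_, ⟨_, π, hst, rfl⟩, ?_⟩
  have hα := M.alpha_pos
  have hq : (π ⬝ᵥ fun z => (z.1 : ℝ)) = M.alpha := by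
    rw [dotProduct, hsum, alpha]
    refine Finset.sum_congr rfl fun a _ => ?_
    have ha := a.2
    simp only
    rw [clip_coe (by omega), ← Finset.sum_mul, ← Finset.mul_sum, M.eta_sum]
    ring
  simp only [averages]
  rw [hq]
  field_simp

/-- All pairs of minimal delay have the same power. -/
lemma fst_eq_of_minimal_snd {x y : ℝ × ℝ} (hx : x ∈ M.steadyPairs) (hy : y ∈ M.steadyPairs)
    (hmin : ∀ w ∈ M.steadyPairs, x.2 ≤ w.2) (hxy : y.2 = x.2) : y.1 = x.1 := by
  obtain ⟨w, hw, hw1⟩ := M.exists_steadyPairs_snd_eq_one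
  have h1 := hmin w hw
  obtain ⟨F, π, hπ, rfl⟩ := hx
  obtain ⟨F', π', hπ', rfl⟩ := hy
  have h2 := one_le_averages_snd hπ
  rw [averages_fst_of_snd_eq_one hπ (by linarith), averages_fst_of_snd_eq_one hπ' (by linarith)]

end MinimalDelay

end FadingLink


/-! ### Plane geometry of the Pareto curve -/

/-- A path of a relation, as a sequence. -/
lemma Relation.ReflTransGen.exists_sequence {α : Type*} {r : α → α → Prop} {a b : α}
    (h : Relation.ReflTransGen r a b) :
    ∃ (N : ℕ) (f : ℕ → α), f 0 = a ∧ f N = b ∧ ∀ n < N, r (f n) (f (n + 1)) := by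
  induction h with
  | refl => exact ⟨0, fun _ => a, rfl, rfl, by simp⟩
  | @tail b c _ hbc ih =>
    obtain ⟨N, f, h0, hN, hf⟩ := ih
    refine ⟨N + 1, fun n => if n ≤ N then f n else c, by simpa using h0, by simp, fun n hn => ?_⟩
    rcases (Nat.lt_succ_iff.1 hn).lt_or_eq with h | rfl
    · simpa [h.le, Nat.succ_le_of_lt h] using hf n h
    · simpa [hN] using hbc

lemma exists_mem_Icc_succ {t : ℕ → ℝ} {N : ℕ} {p : ℝ} (hp : p ∈ Set.Icc (t 0) (t N)) :
    p = t 0 ∨ ∃ n < N, p ∈ Set.Icc (t n) (t (n + 1)) := by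
  induction N with
  | zero => exact Or.inl (le_antisymm hp.2 hp.1)
  | succ N ih =>
    rcases le_total p (t N) with h | h
    · exact (ih ⟨hp.1, h⟩).imp_right fun ⟨n, hn, h'⟩ => ⟨n, by omega, h'⟩
    · exact Or.inr ⟨N, by omega, h, hp.2⟩

/-- The points of `O` that minimize the second coordinate under a bound on the first one. -/
def paretoCurve (O : Set (ℝ × ℝ)) : Set (ℝ × ℝ) :=
  {x | x ∈ O ∧ ∃ b : ℝ, x.1 ≤ b ∧ ∀ y ∈ O, y.1 ≤ b → x.2 ≤ y.2}

/-- A polygonal chain of points `Θ 0, …, Θ N` in `O`, whose segments have decreasing direction and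
lie on lines supporting `V ⊇ O`, from minimal first to minimal second coordinate. -/
structure IsSupportedChain (V O : Set (ℝ × ℝ)) (N : ℕ) (Θ : ℕ → ℝ × ℝ) : Prop where
  subset : O ⊆ V
  mem : ∀ n ≤ N, Θ n ∈ O
  segment_subset : ∀ n < N, segment ℝ (Θ n) (Θ (n + 1)) ⊆ O
  fst_lt : ∀ n < N, (Θ n).1 < (Θ (n + 1)).1
  snd_lt : ∀ n < N, (Θ (n + 1)).2 < (Θ n).2
  supported : ∀ n ≤ N, ∃ β > 0, (∀ y ∈ V, (Θ n).1 + β * (Θ n).2 ≤ y.1 + β * y.2) ∧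
    (n < N → (Θ n).1 + β * (Θ n).2 = (Θ (n + 1)).1 + β * (Θ (n + 1)).2)
  fst_zero_le : ∀ y ∈ V, (Θ 0).1 ≤ y.1
  snd_last_le : ∀ y ∈ V, (Θ N).2 ≤ y.2
  fst_eq_of_snd_eq : ∀ y ∈ V, y.2 = (Θ N).2 → y.1 = (Θ N).1

namespace IsSupportedChain

variable {V O : Set (ℝ × ℝ)} {N : ℕ} {Θ : ℕ → ℝ × ℝ}

lemma fst_le (h : IsSupportedChain V O N Θ) {m n : ℕ} (hmn : m ≤ n) (hn : n ≤ N) :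
    (Θ m).1 ≤ (Θ n).1 := by
  induction n, hmn using Nat.le_induction with
  | base => rfl
  | succ n _ ih => exact (ih (by omega)).trans (h.fst_lt n (by omega)).le

/-- The upper envelope of the supporting lines. -/
lemma exists_envelope (h : IsSupportedChain V O N Θ) : ∃ D : ℝ → ℝ,
    StrictAnti D ∧ ConvexOn ℝ Set.univ D ∧ (∀ y ∈ V, D y.1 ≤ y.2) ∧
    (∀ n ≤ N, (Θ n).2 ≤ D (Θ n).1) ∧
    (∀ n < N, ∃ c e : ℝ, (∀ x ∈ Set.Icc (Θ n).1 (Θ (n + 1)).1, D x = c * x + e) ∧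
      (Θ n).2 = c * (Θ n).1 + e ∧ (Θ (n + 1)).2 = c * (Θ (n + 1)).1 + e) := by
  choose! β hβ hsupp hnext using h.supported
  -- The supporting line at `Θ n`, solved for the second coordinate; its slope is `-(1 / β n)`.
  set line : ℕ → ℝ → ℝ := fun n p => -(1 / β n) * p + ((Θ n).1 + β n * (Θ n).2) / β n with hline
  have hne : (Finset.range (N + 1)).Nonempty := ⟨0, by simp⟩
  set D : ℝ → ℝ := fun p => (Finset.range (N + 1)).sup' hne fun n => line n p with hD
  have hle : ∀ n ≤ N, ∀ p, line n p ≤ D p := fun n hn p =>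
    Finset.le_sup' (fun n => line n p) (Finset.mem_range.2 (by omega))
  have hmax : ∀ p, ∃ n ≤ N, D p = line n p := fun p => by
    obtain ⟨n, hn, hnp⟩ := Finset.exists_mem_eq_sup' hne fun n => line n p
    exact ⟨n, by simpa [Nat.lt_succ_iff] using hn, hnp⟩
  have hlineΘ : ∀ n ≤ N, line n (Θ n).1 = (Θ n).2 := fun n hn => by
    have := (hβ n hn).ne'
    simp only [hline]; field_simp; ring
  have hlineΘ' : ∀ n < N, line n (Θ (n + 1)).1 = (Θ (n + 1)).2 := fun n hn => by
    have := (hβ n hn.le).ne'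
    simp only [hline]
    rw [hnext n hn.le hn]
    field_simp; ring
  have hV : ∀ y ∈ V, D y.1 ≤ y.2 := fun y hy => by
    obtain ⟨n, hn, hnp⟩ := hmax y.1
    have h1 := hβ n hn
    rw [hnp]
    simp only [hline]
    rw [show -(1 / β n) * y.1 + ((Θ n).1 + β n * (Θ n).2) / β n =
      ((Θ n).1 + β n * (Θ n).2 - y.1) / β n by field_simp; ring, div_le_iff₀ h1]
    linarith [hsupp n hn y hy]
  refine ⟨D, fun p q hpq => ?_, ⟨convex_univ, fun p _ q _ a b ha hb hab => ?_⟩, hV,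
    fun n hn => (hlineΘ n hn).symm.le.trans (hle n hn _), fun n hn => ⟨-(1 / β n),
      ((Θ n).1 + β n * (Θ n).2) / β n, fun x hx => ?_, (hlineΘ n hn.le).symm,
      (hlineΘ' n hn).symm⟩⟩
  · obtain ⟨n, hn, hnp⟩ := hmax q
    rw [hnp]
    refine lt_of_lt_of_le ?_ (hle n hn p)
    have := mul_lt_mul_of_pos_left hpq (one_div_pos.2 (hβ n hn))
    simp only [hline]
    linarith
  · obtain ⟨n, hn, hnp⟩ := hmax (a • p + b • q)
    have h1 : line n (a • p + b • q) = a • line n p + b • line n q := by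
      simp only [hline, smul_eq_mul]
      linear_combination (-(((Θ n).1 + β n * (Θ n).2) / β n)) * hab
    rw [hnp, h1]
    exact add_le_add (mul_le_mul_of_nonneg_left (hle n hn p) ha)
      (mul_le_mul_of_nonneg_left (hle n hn q) hb)
  · refine le_antisymm ?_ (hle n hn.le x)
    obtain ⟨a, b, ha, hb, hab, rfl⟩ : x ∈ segment ℝ (Θ n).1 (Θ (n + 1)).1 :=
      (segment_eq_Icc (h.fst_lt n hn).le).symm ▸ hx
    -- The point of the segment above `x` belongs to `V`, so it lies above the envelope; no other
    -- supporting line exceeds line `n` here.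
    have hmem := h.subset (h.segment_subset n hn ⟨a, b, ha, hb, hab, rfl⟩)
    refine (hV _ hmem).trans (le_of_eq ?_)
    have h1 := hlineΘ n hn.le
    have h2 := hlineΘ' n hn
    simp only [hline] at h1 h2
    simp only [Prod.snd_add, Prod.smul_snd, smul_eq_mul]
    linear_combination (-a) * h1 - b * h2 + ((Θ n).1 + β n * (Θ n).2) / β n * hab

lemma mem_segment_of_line {x y : ℝ × ℝ} (hxy : x.1 ≤ y.1) {c e p : ℝ} (hx : x.2 = c * x.1 + e)
    (hy : y.2 = c * y.1 + e) (hp : p ∈ Set.Icc x.1 y.1) : (p, c * p + e) ∈ segment ℝ x y := by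
  obtain ⟨a, b, ha, hb, hab, rfl⟩ : p ∈ segment ℝ x.1 y.1 := (segment_eq_Icc hxy).symm ▸ hp
  refine ⟨a, b, ha, hb, hab, Prod.ext rfl ?_⟩
  simp only [Prod.snd_add, Prod.smul_snd, smul_eq_mul]
  rw [hx, hy]
  linear_combination e * hab

/-- The Pareto curve is the supported chain, and the graph of a function. -/
theorem paretoCurve_eq (h : IsSupportedChain V O N Θ) :
    (∃ D : ℝ → ℝ, paretoCurve O = {x | x.1 ∈ Set.Icc (Θ 0).1 (Θ N).1 ∧ x.2 = D x.1} ∧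
      StrictAnti D ∧ ConvexOn ℝ Set.univ D ∧
      ∀ n < N, ∃ c e : ℝ, ∀ x ∈ Set.Icc (Θ n).1 (Θ (n + 1)).1, D x = c * x + e) ∧
    paretoCurve O = {x | ∃ n ≤ N, x = Θ n} ∪ {x | ∃ n < N, x ∈ segment ℝ (Θ n) (Θ (n + 1))} := by
  obtain ⟨D, hanti, hconv, hV, hΘ, hlin⟩ := h.exists_envelope
  have hΘD : ∀ n ≤ N, (Θ n).2 = D (Θ n).1 := fun n hn =>
    (hΘ n hn).antisymm (hV _ (h.subset (h.mem n hn)))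
  have hseg : ∀ n < N, ∀ x ∈ segment ℝ (Θ n) (Θ (n + 1)),
      x.1 ∈ Set.Icc (Θ n).1 (Θ (n + 1)).1 ∧ x.2 = D x.1 := by
    intro n hn x hx
    obtain ⟨c, e, hD, h1, h2⟩ := hlin n hn
    obtain ⟨a, b, ha, hb, hab, rfl⟩ := hx
    have hmem : (a • Θ n + b • Θ (n + 1)).1 ∈ Set.Icc (Θ n).1 (Θ (n + 1)).1 := by
      rw [← segment_eq_Icc (h.fst_lt n hn).le]
      exact ⟨a, b, ha, hb, hab, rfl⟩
    refine ⟨hmem, ?_⟩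
    rw [hD _ hmem]
    simp only [Prod.snd_add, Prod.smul_snd, Prod.fst_add, Prod.smul_fst, smul_eq_mul]
    rw [h1, h2]
    linear_combination e * hab
  have hgraph : ∀ p ∈ Set.Icc (Θ 0).1 (Θ N).1,
      (p, D p) = Θ 0 ∨ ∃ n < N, (p, D p) ∈ segment ℝ (Θ n) (Θ (n + 1)) := by
    intro p hp
    rcases exists_mem_Icc_succ (t := fun n => (Θ n).1) hp with rfl | ⟨n, hn, hpn⟩
    · exact Or.inl (Prod.ext rfl (hΘD 0 (Nat.zero_le _)).symm)
    · obtain ⟨c, e, hD, h1, h2⟩ := hlin n hn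
      refine Or.inr ⟨n, hn, ?_⟩
      rw [hD p hpn]
      exact mem_segment_of_line (h.fst_lt n hn).le h1 h2 hpn
  have hgraphO : ∀ p ∈ Set.Icc (Θ 0).1 (Θ N).1, (p, D p) ∈ O := fun p hp => by
    rcases hgraph p hp with h' | ⟨n, hn, h'⟩
    · exact h' ▸ h.mem 0 (Nat.zero_le _)
    · exact h.segment_subset n hn h'
  have hcurve : paretoCurve O = {x | x.1 ∈ Set.Icc (Θ 0).1 (Θ N).1 ∧ x.2 = D x.1} := by
    ext x
    constructor
    · rintro ⟨hxO, b, hxb, hmin⟩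
      have hx0 := h.fst_zero_le x (h.subset hxO)
      have hxN : x.1 ≤ (Θ N).1 := by
        -- With more power than `Θ N`, the point would have to match its minimal delay, and then
        -- `fst_eq_of_snd_eq` makes the powers equal.
        by_contra! hlt
        have h1 := hmin (Θ N) (h.mem N le_rfl) (hlt.le.trans hxb)
        have h2 := h.snd_last_le x (h.subset hxO)
        exact hlt.ne' (h.fst_eq_of_snd_eq x (h.subset hxO) (le_antisymm h1 h2))
      exact ⟨⟨hx0, hxN⟩, le_antisymm (hmin _ (hgraphO x.1 ⟨hx0, hxN⟩) hxb)
        (hV x (h.subset hxO))⟩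
    · rintro ⟨hx, hxD⟩
      have hxeq : x = (x.1, D x.1) := Prod.ext rfl hxD
      refine ⟨hxeq ▸ hgraphO x.1 hx, x.1, le_rfl, fun y hy hyx => ?_⟩
      rw [hxD]
      exact (hanti.antitone hyx).trans (hV y (h.subset hy))
  refine ⟨⟨D, hcurve, hanti, hconv, fun n hn => ?_⟩, ?_⟩
  · obtain ⟨c, e, hD, -⟩ := hlin n hn
    exact ⟨c, e, hD⟩
  · rw [hcurve]
    ext x
    constructor
    · rintro ⟨hx, hxD⟩
      have hxeq : x = (x.1, D x.1) := Prod.ext rfl hxD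
      rcases hgraph x.1 hx with h' | h'
      · exact Or.inl ⟨0, Nat.zero_le _, hxeq.trans h'⟩
      · exact Or.inr (by rwa [← hxeq] at h')
    · rintro (⟨n, hn, rfl⟩ | ⟨n, hn, hx⟩)
      · exact ⟨⟨h.fst_le (Nat.zero_le n) hn, h.fst_le hn le_rfl⟩, hΘD n hn⟩
      · obtain ⟨hx1, hx2⟩ := hseg n hn x hx
        exact ⟨⟨(h.fst_le (Nat.zero_le n) hn.le).trans hx1.1,
          hx1.2.trans (h.fst_le hn le_rfl)⟩, hx2⟩

/-- An extreme point on a segment whose ends belong to the curve is one of these ends. -/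
lemma extremePoints_subset (h : IsSupportedChain V O N Θ) :
    (paretoCurve O).extremePoints ℝ ⊆ {x | ∃ n ≤ N, x = Θ n} := by
  intro x hx
  have hcurve := h.paretoCurve_eq.2
  have hmem := hx.1
  rw [hcurve] at hmem
  rcases hmem with hx' | ⟨n, hn, hx'⟩
  · exact hx'
  rw [mem_extremePoints_iff_forall_segment] at hx
  have hΘ : ∀ k ≤ N, Θ k ∈ paretoCurve O := fun k hk => by
    rw [hcurve]; exact Or.inl ⟨k, hk, rfl⟩
  rcases hx.2 _ (hΘ n hn.le) _ (hΘ (n + 1) hn) hx' with h' | h'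
  · exact ⟨n, hn.le, h'.symm⟩
  · exact ⟨n + 1, hn, h'.symm⟩

end IsSupportedChain

/-! ### The supported chain of the link and the theorem -/

namespace FadingLink

open Policy

variable {M : FadingLink}

/-- Linked pairs lie on a common supporting line with `β > 0`. Equal delays therefore force equal
pairs, and such links are dropped; a strict decrease of delay forces a strict increase of power. -/
lemma exists_isSupportedChain (M : FadingLink) (z₀ : M.State) : ∃ (N : ℕ) (Θ : ℕ → ℝ × ℝ),
    IsSupportedChain M.steadyPairs (M.obtainable z₀) N Θ ∧
      (∀ n ≤ N, ∃ F : M.Policy, F.Obtains (Θ n)) ∧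
      ∀ n < N, ∃ F F' : M.Policy,
        F.Obtains (Θ n) ∧ F'.Obtains (Θ (n + 1)) ∧ F.DifferInOneState F' := by
  obtain ⟨x₀, ⟨d₀, hd₀, h₀⟩, x₁, -, hmin₀, hmin₁, ⟨β₁, hβ₁, hw₁⟩, hchain⟩ := M.exists_full_chain
  have hstrict : Relation.ReflTransGen
      (fun x x' => M.Linked x x' ∧ x.1 < x'.1 ∧ x'.2 < x.2) x₀ x₁ := by
    clear hmin₁ hw₁
    induction hchain with
    | refl => exact .refl
    | @tail x x' _ hlink ih =>
      obtain ⟨F, F', hF, hF', -, hle, β, hβ, hw, hw'⟩ := id hlink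
      have h1 := hw x' (mem_steadyPairs_of_obtains hF')
      have h2 := hw' x (mem_steadyPairs_of_obtains hF)
      rcases hle.lt_or_eq with hlt | heq
      · refine ih.tail ⟨hlink, ?_, hlt⟩
        nlinarith [mul_lt_mul_of_pos_left hlt hβ]
      · rw [heq] at h1 h2
        rwa [show x' = x from Prod.ext (by linarith) heq]
  obtain ⟨N, Θ, rfl, rfl, hΘ⟩ := hstrict.exists_sequence
  have hobt : ∀ n ≤ N, ∃ F : M.Policy, F.Obtains (Θ n) := by
    rintro (_ | n) hn
    · exact ⟨_, h₀⟩
    · obtain ⟨-, F', -, hF', -⟩ := (hΘ n hn).1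
      exact ⟨F', hF'⟩
  have hdiff : ∀ n < N, ∃ F F' : M.Policy,
      F.Obtains (Θ n) ∧ F'.Obtains (Θ (n + 1)) ∧ F.DifferInOneState F' := fun n hn => by
    obtain ⟨F, F', hF, hF', hdiff, -⟩ := (hΘ n hn).1
    exact ⟨F, F', hF, hF', hdiff⟩
  refine ⟨N, Θ, ⟨obtainable_subset z₀, fun n hn => ?_, fun n hn => ?_, fun n hn => (hΘ n hn).2.1,
    fun n hn => (hΘ n hn).2.2, fun n hn => ?_, hmin₀, hmin₁, fun y hy hyN => ?_⟩, hobt, hdiff⟩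
  · obtain ⟨F, hF⟩ := hobt n hn
    exact ⟨F, hF.2.2 z₀⟩
  · obtain ⟨F, F', hF, hF', hFF'⟩ := hdiff n hn
    exact segment_subset_obtainable hF hF' hFF' z₀
  · rcases hn.lt_or_eq with hlt | rfl
    · obtain ⟨F, F', hF, hF', -, -, β, hβ, hw, hw'⟩ := (hΘ n hlt).1
      exact ⟨β, hβ, hw, fun _ => le_antisymm (hw _ (mem_steadyPairs_of_obtains hF'))
        (hw' _ (mem_steadyPairs_of_obtains hF))⟩
    · exact ⟨β₁, hβ₁, hw₁, fun h => absurd h (lt_irrefl _)⟩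
  · obtain ⟨F, hF⟩ := hobt N le_rfl
    exact fst_eq_of_minimal_snd (mem_steadyPairs_of_obtains hF) hy hmin₁ hyN

end FadingLink

end

theorem theorem7 (M : FadingLink) (z₀ : M.State) :
    (∃ (pmin pmax : ℝ) (D : ℝ → ℝ), pmin ≤ pmax ∧
      M.curve z₀ = {x : ℝ × ℝ | x.1 ∈ Set.Icc pmin pmax ∧ x.2 = D x.1} ∧
      IsPiecewiseLinearOn D pmin pmax ∧
      StrictAntiOn D (Set.Icc pmin pmax) ∧
      ConvexOn ℝ (Set.Icc pmin pmax) D) ∧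
    (∀ v ∈ (M.curve z₀).extremePoints ℝ, ∃ F : M.Policy, F.Obtains v) ∧
    (∃ (N : ℕ) (Θ : Fin (N + 1) → ℝ × ℝ),
      StrictMono (fun n => (Θ n).1) ∧ StrictAnti (fun n => (Θ n).2) ∧
      (M.curve z₀).extremePoints ℝ ⊆ Set.range Θ ∧
      M.curve z₀ = Set.range Θ ∪ ⋃ n : Fin N, segment ℝ (Θ n.castSucc) (Θ n.succ) ∧
      (∀ n, ∃ F : M.Policy, F.Obtains (Θ n)) ∧
      ∀ n : Fin N, ∃ F F' : M.Policy,
        F.Obtains (Θ n.castSucc) ∧ F'.Obtains (Θ n.succ) ∧ F.DifferInOneState F') := by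
  obtain ⟨N, Θ, h, hobt, hdiff⟩ := M.exists_isSupportedChain z₀
  obtain ⟨⟨D, hgraph, hanti, hconv, hlin⟩, hunion⟩ := h.paretoCurve_eq
  have hmono : StrictMono fun n : Fin (N + 1) => (Θ n).1 :=
    Fin.strictMono_iff_lt_succ.2 fun n => h.fst_lt n n.2
  refine ⟨⟨(Θ 0).1, (Θ N).1, D, h.fst_le (Nat.zero_le N) le_rfl, hgraph,
    ⟨N, fun n => (Θ n).1, hmono, rfl, rfl, fun n => hlin n n.2⟩, hanti.strictAntiOn _,
    hconv.subset (Set.subset_univ _) (convex_Icc _ _)⟩, fun v hv => ?_,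
    N, fun n => Θ n, hmono, Fin.strictAnti_iff_succ_lt.2 fun n => h.snd_lt n n.2, ?_, ?_,
    fun n => hobt n (Nat.lt_succ_iff.1 n.2), fun n => hdiff n n.2⟩
  · obtain ⟨n, hn, rfl⟩ := h.extremePoints_subset hv
    exact hobt n hn
  · intro v hv
    obtain ⟨n, hn, rfl⟩ := h.extremePoints_subset hv
    exact ⟨⟨n, Nat.lt_succ_of_le hn⟩, rfl⟩
  · refine hunion.trans (congr_arg₂ _ ?_ ?_)
    · ext x
      constructor
      · rintro ⟨n, hn, rfl⟩
        exact ⟨⟨n, Nat.lt_succ_of_le hn⟩, rfl⟩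
      · rintro ⟨n, rfl⟩
        exact ⟨n, Nat.lt_succ_iff.1 n.2, rfl⟩
    · ext x
      simp only [Set.mem_iUnion]
      constructor
      · rintro ⟨n, hn, hx⟩
        exact ⟨⟨n, hn⟩, hx⟩
      · rintro ⟨n, hx⟩
        exact ⟨n, n.2, hx⟩
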